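/- Let $M$ be a connected, Hausdorff, second countable smooth manifold of dimension $n\ge 2$, let $\tau\colon TM\to M$ be its tangent bundle and $\mathring TM$ the set of nonzero tangent vectors. Let $F\colon TM\to\mathbb R$ be a Finsler function: $F$ is smooth and positive on $\mathring TM$, $F(\lambda v)=\lambda F(v)$ for all $v\in TM$ and $\lambda>0$, and, with $E:=\tfrac12F^2$, the metric tensor $g$, given at $v\in\mathring TM$ by the second derivative at $v$ of the restriction of $E$ to $T_{\tau(v)}M$, is non-degenerate. Let $\mathbf J$ be the vertical endomorphism of $TTM$, $C$ the Liouville vector field on $TM$, $\omega:=d(dE\circ\mathbf J)$ the fundamental 2-form on $\mathring TM$, and $$\sigma:=\frac{(-1)^{n(n-1)/2}}{n!}\,\omega^{n}=\frac{(-1)^{n(n-1)/2}}{n!}\,\underbrace{\omega\wedge\dots\wedge\omega}_{n}$$ the Dazord volume form on $\mathring TM$. Let $S$ be the canonical spray, i.e. the vector field on $TM$ with $i_S\omega=-dE$ on $\mathring TM$ and $S=0$ on the zero section. For a smooth vector field $X$ on $M$ let $X^{\mathsf c}$ be its complete lift to $TM$ (in induced coordinates, $X^{\mathsf c}=X^i\frac{\partial}{\partial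 x^i}+y^j\frac{\partial X^i}{\partial x^j}\frac{\partial}{\partial y^i}$). For a section $Y$ along $\tau$ (so $Y(v)\in T_{\tau(v)}M$), let $\mathbf iY$ denote the corresponding vertical vector field and put $\widetilde{\mathcal L}_{X^{\mathsf c}}Y:=\mathbf i^{-1}[X^{\mathsf c},\mathbf iY]$ and $(\widetilde{\mathcal L}_{X^{\mathsf c}}g)(Y,Z):=X^{\mathsf c}(g(Y,Z))-g(\widetilde{\mathcal L}_{X^{\mathsf c}}Y,Z)-g(Y,\widetilde{\mathcal L}_{X^{\mathsf c}}Z)$. The field $X$ is called * projective if $[X^{\mathsf c},S]=\varphi\,C$ on $TM$ for some continuous $\varphi\colon TM\to\mathbb R$ that is smooth on $\mathring TM$, and affine if $[X^{\mathsf c},S]=0$ on $TM$; * conformal if $\widetilde{\mathcal L}_{X^{\mathsf c}}g=\varphi\,g$ on $\mathring TM$ for some continuous $\varphi\colon TM\to\mathbb R$ that is of class $C^1$ on $\mathring TM$, and isometric (Killing) if $\widetilde{\mathcal L}_{X^{\mathsf c}}g=0$ on $\mathring TM$. Suppose that $X$ preserves the Dazord volume form, i.e. $\mathcal L_{X^{\mathsf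 c}}\sigma=0$ on $\mathring TM$. Then: (i) if $X$ is projective, then $X$ is affine; (ii) if $X$ is conformal, then $X$ is isometric. -/

import Mathlib

open Set Bundle VectorField
open scoped Manifold ContDiff Topology

namespace Finsler

/-- The exterior derivative `dα` of a differential form `α` on a manifold, computed in the preferred
chart at each point. -/
noncomputable def mextDeriv {V H : Type*} [NormedAddCommGroup V] [NormedSpace ℝ V]
    [TopologicalSpace H] (J : ModelWithCorners ℝ V H) {N : Type*} [TopologicalSpace N]
    [ChartedSpace H N] {k : ℕ} (α : (x : N) → TangentSpace J x [⋀^Fin k]→L[ℝ] ℝ) (x : N) :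
    TangentSpace J x [⋀^Fin (k + 1)]→L[ℝ] ℝ :=
  (extDerivWithin
      (fun y : V ↦ (α ((extChartAt J x).symm y)).compContinuousLinearMap
        (mfderivWithin 𝓘(ℝ, V) J (extChartAt J x).symm (range J) y))
      (range J) (extChartAt J x x)).compContinuousLinearMap
    (mfderiv J 𝓘(ℝ, V) (extChartAt J x) x)

/-- The derivative `z f` of a real function `f` on a manifold along a tangent vector `z`. -/
noncomputable def dirDeriv {V H : Type*} [NormedAddCommGroup V] [NormedSpace ℝ V]
    [TopologicalSpace H] (J : ModelWithCorners ℝ V H) {N : Type*} [TopologicalSpace N]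
    [ChartedSpace H N] (f : N → ℝ) (x : N) (z : TangentSpace J x) : ℝ :=
  mfderiv J 𝓘(ℝ, ℝ) f x z

/-- The Lie derivative of a `k`-form `σ` along a vector field `ξ`,
evaluated on vector fields `η₁, …, ηₖ`:
`(L_ξ σ)(η₁, …, ηₖ) = ξ (σ(η₁, …, ηₖ)) - ∑ᵢ σ(η₁, …, [ξ, ηᵢ], …, ηₖ)`. -/
noncomputable def lieDerivForm {V H : Type*} [NormedAddCommGroup V] [NormedSpace ℝ V]
    [TopologicalSpace H] (J : ModelWithCorners ℝ V H) {N : Type*} [TopologicalSpace N]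
    [ChartedSpace H N] {k : ℕ} (ξ : (x : N) → TangentSpace J x)
    (σ : (x : N) → TangentSpace J x [⋀^Fin k]→ₗ[ℝ] ℝ)
    (η : Fin k → (x : N) → TangentSpace J x) (x : N) : ℝ :=
  dirDeriv J (fun y ↦ σ y (fun i ↦ η i y)) x (ξ x)
    - ∑ i, σ x (Function.update (fun j ↦ η j x) i (mlieBracket J ξ (η i) x))

/-- The wedge product of two alternating forms (sum over shuffles). -/
noncomputable def wedge {V : Type*} [AddCommGroup V] [Module ℝ V] {k l : ℕ}
    (α : V [⋀^Fin k]→ₗ[ℝ] ℝ) (β : V [⋀^Fin l]→ₗ[ℝ] ℝ) : V [⋀^Fin (k + l)]→ₗ[ℝ] ℝ :=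
  ((LinearMap.mul' ℝ ℝ).compAlternatingMap (α.domCoprod β)).domDomCongr finSumFinEquiv

/-- The `m`-th exterior power `α ∧ ⋯ ∧ α` (`m` factors) of a 2-form `α`. -/
noncomputable def wedgePow {V : Type*} [AddCommGroup V] [Module ℝ V]
    (α : V [⋀^Fin 2]→ₗ[ℝ] ℝ) : (m : ℕ) → V [⋀^Fin (2 * m)]→ₗ[ℝ] ℝ
  | 0 => AlternatingMap.constOfIsEmpty ℝ V (Fin 0) 1
  | m + 1 => wedge (wedgePow α m) α

section Tangent

variable {n : ℕ} {M : Type*} [TopologicalSpace M] [ChartedSpace (EuclideanSpace ℝ (Fin n)) M]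
  [IsManifold (𝓡 n) ∞ M]

/-- The derivative `τ_* : T_v TM → T_{τ(v)} M` of the projection `τ : TM → M`; it is the pointwise
form of the map `𝐣`. -/
noncomputable def jmap (v : TangentBundle (𝓡 n) M) :
    TangentSpace (𝓡 n).tangent v →L[ℝ] TangentSpace (𝓡 n) v.proj :=
  mfderiv (𝓡 n).tangent (𝓡 n) (fun u : TangentBundle (𝓡 n) M ↦ u.proj) v

/-- The vertical lift `T_{τ(v)} M → T_v TM`, sending `w` to the velocity at `t = 0` of
`t ↦ v + t w`; it is the pointwise form of the map `𝐢`. -/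
noncomputable def vlift (v : TangentBundle (𝓡 n) M) :
    TangentSpace (𝓡 n) v.proj →L[ℝ] TangentSpace (𝓡 n).tangent v :=
  mfderiv 𝓘(ℝ, EuclideanSpace ℝ (Fin n)) (𝓡 n).tangent
    (fun w : EuclideanSpace ℝ (Fin n) ↦ (⟨v.proj, w⟩ : TangentBundle (𝓡 n) M)) v.snd

/-- The Liouville vector field `C` on `TM`. -/
noncomputable def liouville (v : TangentBundle (𝓡 n) M) : TangentSpace (𝓡 n).tangent v :=
  vlift v v.snd

/-- The complete lift `X^c` of a vector field `X` on `M`. The tangent space `T_v TM` is `E × E`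
through the chart of `TM` induced by the preferred chart of `M` at `τ(v)`; in these coordinates the
second component of the derivative of the section `X : M → TM` along `v` is `∑ⱼ yʲ ∂ⱼXⁱ`, so that
`X^c = ∑ᵢ Xⁱ ∂/∂xⁱ + ∑ᵢⱼ yʲ (∂ⱼXⁱ) ∂/∂yⁱ`. -/
noncomputable def completeLift (X : (p : M) → TangentSpace (𝓡 n) p)
    (v : TangentBundle (𝓡 n) M) : TangentSpace (𝓡 n).tangent v :=
  ((X v.proj,
    (mfderiv (𝓡 n) (𝓡 n).tangent (fun p ↦ (⟨p, X p⟩ : TangentBundle (𝓡 n) M)) v.proj v.snd :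
      EuclideanSpace ℝ (Fin n) × EuclideanSpace ℝ (Fin n)).2) :
    EuclideanSpace ℝ (Fin n) × EuclideanSpace ℝ (Fin n))

variable (n M) in
/-- The set of nonzero tangent vectors, i.e. the deleted bundle as an open subset of `TM`. -/
def deleted : Set (TangentBundle (𝓡 n) M) := {v | v.snd ≠ 0}

/-- The energy `E = F² / 2`. -/
noncomputable def energy (F : TangentBundle (𝓡 n) M → ℝ) (v : TangentBundle (𝓡 n) M) : ℝ :=
  F v ^ 2 / 2

/-- The metric tensor `g = ½ ∇ᵛ∇ᵛ F²`: at `v`, the Hessian at `v` of the restriction of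
`½ F²` to the vector space `T_{τ(v)} M`. -/
noncomputable def metric (F : TangentBundle (𝓡 n) M → ℝ) (v : TangentBundle (𝓡 n) M)
    (a b : TangentSpace (𝓡 n) v.proj) : ℝ :=
  fderiv ℝ (fderiv ℝ (fun w : EuclideanSpace ℝ (Fin n) ↦ energy F ⟨v.proj, w⟩)) v.snd a b

/-- `F` is a Finsler function on `M`. -/
structure IsFinsler (F : TangentBundle (𝓡 n) M → ℝ) : Prop where
  smooth : ContMDiffOn (𝓡 n).tangent 𝓘(ℝ, ℝ) ∞ F (deleted n M)
  pos : ∀ v ∈ deleted n M, 0 < F v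
  homog : ∀ (p : M) (w : TangentSpace (𝓡 n) p) (c : ℝ), 0 < c → F ⟨p, c • w⟩ = c * F ⟨p, w⟩
  nondegenerate : ∀ v ∈ deleted n M, ∀ a : TangentSpace (𝓡 n) v.proj,
    (∀ b : TangentSpace (𝓡 n) v.proj, metric F v a b = 0) → a = 0

/-- The Hilbert 1-form `θ = d_J E = dE ∘ J`, where `J = 𝐢 ∘ 𝐣`. -/
noncomputable def hilbertForm (F : TangentBundle (𝓡 n) M → ℝ) (v : TangentBundle (𝓡 n) M) :
    TangentSpace (𝓡 n).tangent v [⋀^Fin 1]→L[ℝ] ℝ :=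
  ContinuousAlternatingMap.ofSubsingleton ℝ (TangentSpace (𝓡 n).tangent v) ℝ (0 : Fin 1)
    ((mfderiv (𝓡 n).tangent 𝓘(ℝ, ℝ) (energy F) v).comp ((vlift v).comp (jmap v)))

/-- The fundamental 2-form `ω = dθ = d d_J E`. -/
noncomputable def fundForm (F : TangentBundle (𝓡 n) M → ℝ) (v : TangentBundle (𝓡 n) M) :
    TangentSpace (𝓡 n).tangent v [⋀^Fin 2]→L[ℝ] ℝ :=
  mextDeriv (𝓡 n).tangent (hilbertForm F) v

/-- The Dazord volume form `σ = ((-1)^(n(n-1)/2) / n!) ω ∧ ⋯ ∧ ω` (`n` factors). -/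
noncomputable def dazord (F : TangentBundle (𝓡 n) M → ℝ) (v : TangentBundle (𝓡 n) M) :
    TangentSpace (𝓡 n).tangent v [⋀^Fin (2 * n)]→ₗ[ℝ] ℝ :=
  ((-1 : ℝ) ^ (n * (n - 1) / 2) / (n.factorial : ℝ)) •
    wedgePow (fundForm F v).toAlternatingMap n

/-- The canonical spray: the vector field `S` on `TM` with `i_S ω = -dE` off the zero section and
`S = 0` on the zero section (the form `ω` is nondegenerate at every nonzero `v`, so `S v` is the only
vector with this property). -/
noncomputable def canonicalSpray (F : TangentBundle (𝓡 n) M → ℝ) (v : TangentBundle (𝓡 n) M) :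
    TangentSpace (𝓡 n).tangent v :=
  open Classical in
  if v.snd = 0 then 0
  else Classical.epsilon fun s ↦ ∀ z : TangentSpace (𝓡 n).tangent v,
    fundForm F v ![s, z] = -dirDeriv (𝓡 n).tangent (energy F) v z

/-- `X` is projective: `[X^c, S] = φ C` on `TM` for the canonical spray `S` and some function `φ`
that is continuous on `TM` and smooth off the zero section. -/
def IsProjective (F : TangentBundle (𝓡 n) M → ℝ) (X : (p : M) → TangentSpace (𝓡 n) p) : Prop :=
  ∃ φ : TangentBundle (𝓡 n) M → ℝ, Continuous φ ∧
    ContMDiffOn (𝓡 n).tangent 𝓘(ℝ, ℝ) ∞ φ (deleted n M) ∧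
    ∀ v, mlieBracket (𝓡 n).tangent (completeLift X) (canonicalSpray F) v = φ v • liouville v

/-- `X` is affine: `[X^c, S] = 0` on `TM` for the canonical spray `S`. -/
def IsAffine (F : TangentBundle (𝓡 n) M → ℝ) (X : (p : M) → TangentSpace (𝓡 n) p) : Prop :=
  ∀ v, mlieBracket (𝓡 n).tangent (completeLift X) (canonicalSpray F) v = 0

/-- `X` preserves the Dazord volume form: `L_{X^c} σ = 0` on the deleted bundle, tested on arbitrary
local smooth vector fields. -/
def PreservesVolume (F : TangentBundle (𝓡 n) M → ℝ) (X : (p : M) → TangentSpace (𝓡 n) p) : Prop :=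
  ∀ v ∈ deleted n M, ∀ η : Fin (2 * n) → (u : TangentBundle (𝓡 n) M) → TangentSpace (𝓡 n).tangent u,
    (∀ i, ContMDiffAt (𝓡 n).tangent (𝓡 n).tangent.tangent ∞
      (fun u ↦ (⟨u, η i u⟩ : TangentBundle (𝓡 n).tangent (TangentBundle (𝓡 n) M))) v) →
    lieDerivForm (𝓡 n).tangent (completeLift X) (dazord F) η v = 0

/-- The Lie derivative `𝐢⁻¹ [X^c, 𝐢 Y]` of a section `Y` along the projection `τ` (that is,
`Y v ∈ T_{τ(v)} M` for each `v ∈ TM`). The bracket is vertical and `𝐢` is injective. -/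
noncomputable def lieDerivSection (X : (p : M) → TangentSpace (𝓡 n) p)
    (Y : (v : TangentBundle (𝓡 n) M) → TangentSpace (𝓡 n) v.proj) (v : TangentBundle (𝓡 n) M) :
    TangentSpace (𝓡 n) v.proj :=
  Function.invFun (vlift v)
    (mlieBracket (𝓡 n).tangent (completeLift X) (fun u ↦ vlift u (Y u)) v)

/-- The Lie derivative of the metric tensor along `X^c`, evaluated on sections `Y`, `Z` along `τ`:
`X^c (g(Y, Z)) - g(L Y, Z) - g(Y, L Z)`. -/
noncomputable def lieDerivMetric (F : TangentBundle (𝓡 n) M → ℝ)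
    (X : (p : M) → TangentSpace (𝓡 n) p)
    (Y Z : (v : TangentBundle (𝓡 n) M) → TangentSpace (𝓡 n) v.proj)
    (v : TangentBundle (𝓡 n) M) : ℝ :=
  dirDeriv (𝓡 n).tangent (fun u ↦ metric F u (Y u) (Z u)) v (completeLift X v)
    - metric F v (lieDerivSection X Y v) (Z v) - metric F v (Y v) (lieDerivSection X Z v)

/-- `L_{X^c} g = φ g` on the deleted bundle, tested on arbitrary local smooth sections along `τ`. -/
def HasConformalFactor (F : TangentBundle (𝓡 n) M → ℝ) (X : (p : M) → TangentSpace (𝓡 n) p)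
    (φ : TangentBundle (𝓡 n) M → ℝ) : Prop :=
  ∀ v ∈ deleted n M, ∀ Y Z : (u : TangentBundle (𝓡 n) M) → TangentSpace (𝓡 n) u.proj,
    ContMDiffAt (𝓡 n).tangent (𝓡 n).tangent ∞
      (fun u ↦ (⟨u.proj, Y u⟩ : TangentBundle (𝓡 n) M)) v →
    ContMDiffAt (𝓡 n).tangent (𝓡 n).tangent ∞
      (fun u ↦ (⟨u.proj, Z u⟩ : TangentBundle (𝓡 n) M)) v →
    lieDerivMetric F X Y Z v = φ v * metric F v (Y v) (Z v)

/-- `X` is conformal: `L_{X^c} g = φ g` for some function `φ` that is continuous on `TM` and of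
class `C¹` off the zero section. -/
def IsConformal (F : TangentBundle (𝓡 n) M → ℝ) (X : (p : M) → TangentSpace (𝓡 n) p) : Prop :=
  ∃ φ : TangentBundle (𝓡 n) M → ℝ, Continuous φ ∧
    ContMDiffOn (𝓡 n).tangent 𝓘(ℝ, ℝ) 1 φ (deleted n M) ∧ HasConformalFactor F X φ

/-- `X` is isometric (a Killing field): it is conformal with conformal factor zero. -/
def IsIsometric (F : TangentBundle (𝓡 n) M → ℝ) (X : (p : M) → TangentSpace (𝓡 n) p) : Prop :=
  HasConformalFactor F X fun _ ↦ 0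

end Tangent
end Finsler

/-! Everything is a statement about divergences. In an induced chart of `TM` the fundamental form is
the pullback of the standard symplectic form under the derivative of the Legendre map, whose
determinant is that of the matrix of `g`. Hence `σ` is a nonzero constant times `det g` times the
standard volume (`dazord_apply`), and preserving `σ` means having zero divergence for the density
`det g` (`densityDiv_liftCoord`).

Projective case: the spray is Hamiltonian for `ω`, so it preserves `ω` and is itself divergence free
(`densityDiv_sprayCoord`). The bracket of two divergence free fields is divergence free
(`densityDiv_lieBracket`), so `φ C` is. Since `E` is homogeneous of degree 2, `det g` is constant
along rays, and `C` has divergence `n`; thus `Cφ + nφ = 0`, i.e. `φ` has degree `-n` on every open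
ray. Such a function cannot stay bounded near the zero section, where `φ` is continuous, unless it
vanishes (`eq_zero_of_homogeneous_neg`). On the zero section `C` itself is zero.

Conformal case: let `A` be the Jacobian matrix of `X` in a chart. Conformality reads `X^c(g) = φ g -
Aᵀ g - g A`, so Jacobi's formula gives `X^c(det g) = (nφ - 2 tr A) det g`. The coordinate divergence
of `X^c` is `2 tr A`, so the divergence for `det g` is `nφ det g`; it is zero only if `φ = 0`
(`conformalFactor_eq_zero`). -/

namespace Finsler

/-! ### Vector fields, brackets and exterior derivatives read in a fixed chart. -/

section Charts

variable {V H : Type*} [NormedAddCommGroup V] [NormedSpace ℝ V] [TopologicalSpace H]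
  (J : ModelWithCorners ℝ V H) {N : Type*} [TopologicalSpace N] [ChartedSpace H N]

/-- The derivative at `u` of the preferred chart at `x₀`. -/
noncomputable def chartDeriv (x₀ u : N) : TangentSpace J u →L[ℝ] V :=
  mfderiv J 𝓘(ℝ, V) (extChartAt J x₀) u

/-- The vector field whose expression in the preferred chart at `x₀` is `ξ'`. -/
noncomputable def chartField (x₀ : N) (ξ' : V → V) (u : N) : TangentSpace J u :=
  (chartDeriv J x₀ u).inverse (ξ' (extChartAt J x₀ u))

variable {J} {x₀ u : N}

theorem isInvertible_chartDeriv [IsManifold J 1 N] (hu : u ∈ (extChartAt J x₀).source) :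
    (chartDeriv J x₀ u).IsInvertible :=
  isInvertible_mfderiv_extChartAt hu

theorem chartDeriv_injective [IsManifold J 1 N] (hu : u ∈ (extChartAt J x₀).source) :
    Function.Injective (chartDeriv J x₀ u) :=
  (isInvertible_chartDeriv hu).injective

theorem chartDeriv_surjective [IsManifold J 1 N] (hu : u ∈ (extChartAt J x₀).source) :
    Function.Surjective (chartDeriv J x₀ u) :=
  (isInvertible_chartDeriv hu).surjective

theorem hasMFDerivAt_extChartAt_chartDeriv [IsManifold J 1 N]
    (hu : u ∈ (extChartAt J x₀).source) :
    HasMFDerivAt J 𝓘(ℝ, V) (extChartAt J x₀) u (chartDeriv J x₀ u) :=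
  (mdifferentiableAt_extChartAt (by simpa using hu)).hasMFDerivAt

/-- The chain rule for a map into a manifold, read in a chart of the target. -/
theorem chartDeriv_mfderiv [IsManifold J 1 N] {V' H' : Type*} [NormedAddCommGroup V']
    [NormedSpace ℝ V'] [TopologicalSpace H'] {J' : ModelWithCorners ℝ V' H'} {N' : Type*}
    [TopologicalSpace N'] [ChartedSpace H' N'] {f : N' → N} {x : N'}
    (hu : f x ∈ (extChartAt J x₀).source) (hf : MDifferentiableAt J' J f x)
    (s : TangentSpace J' x) :
    chartDeriv J x₀ (f x) (mfderiv J' J f x s) =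
      mfderiv J' 𝓘(ℝ, V) (extChartAt J x₀ ∘ f) x s := by
  rw [((hasMFDerivAt_extChartAt_chartDeriv hu).comp x hf.hasMFDerivAt).mfderiv]
  rfl

/-- The tangent space at `u` is by construction the model space seen through the preferred chart at
`u`. This links definitions made pointwise in preferred charts to computations in one fixed chart.
-/
theorem chartDeriv_self [IsManifold J 1 N] (s : TangentSpace J u) : chartDeriv J u u s = s := by
  rw [chartDeriv, ← TangentBundle.continuousLinearMapAt_trivializationAt (by simp),
    TangentBundle.continuousLinearMapAt_trivializationAt_eq_core (by simp)]
  exact (tangentBundleCore J N).coordChange_self _ _ (by simp) _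

/-- The derivative of a change of charts. -/
theorem fderiv_chart_transition [J.Boundaryless] [IsManifold J 1 N] {x₁ : N}
    (hu : u ∈ (extChartAt J x₀).source) (hu₁ : u ∈ (extChartAt J x₁).source)
    (s : TangentSpace J u) :
    fderiv ℝ (extChartAt J x₀ ∘ (extChartAt J x₁).symm) (extChartAt J x₁ u)
      (chartDeriv J x₁ u s) = chartDeriv J x₀ u s := by
  have hΨ : DifferentiableAt ℝ (extChartAt J x₀ ∘ (extChartAt J x₁).symm)
      (extChartAt J x₁ u) := by
    have := contDiffWithinAt_ext_coord_change (I := J) (n := 1) x₀ x₁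
      (y := extChartAt J x₁ u) (by
        rw [PartialEquiv.trans_source]
        exact ⟨(extChartAt J x₁).map_source hu₁,
          by rwa [mem_preimage, (extChartAt J x₁).left_inv hu₁]⟩)
    rw [J.range_eq_univ, contDiffWithinAt_univ] at this
    exact this.differentiableAt one_ne_zero
  have h1 := (hΨ.hasFDerivAt.hasMFDerivAt).comp u
    (hasMFDerivAt_extChartAt_chartDeriv (J := J) hu₁)
  have h2 : mfderiv J 𝓘(ℝ, V) ((extChartAt J x₀ ∘ (extChartAt J x₁).symm) ∘ extChartAt J x₁) u =
      mfderiv J 𝓘(ℝ, V) (extChartAt J x₀) u := by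
    refine Filter.EventuallyEq.mfderiv_eq ?_
    filter_upwards [(isOpen_extChartAt_source (I := J) x₁).mem_nhds hu₁] with w hw
    simp only [Function.comp_apply, (extChartAt J x₁).left_inv hw]
  exact DFunLike.congr_fun (h1.mfderiv.symm.trans h2) s

theorem dirDeriv_eq_of_chart [IsManifold J 1 N] {f : N → ℝ} {f' : V → ℝ}
    (hu : u ∈ (extChartAt J x₀).source) (hf : f =ᶠ[𝓝 u] f' ∘ extChartAt J x₀)
    (hf' : DifferentiableAt ℝ f' (extChartAt J x₀ u)) (s : TangentSpace J u) :
    dirDeriv J f u s = fderiv ℝ f' (extChartAt J x₀ u) (chartDeriv J x₀ u s) := by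
  have h := (hf'.hasFDerivAt.hasMFDerivAt.comp u (hasMFDerivAt_extChartAt_chartDeriv hu))
  rw [dirDeriv, hf.mfderiv_eq, h.mfderiv]
  rfl

theorem chartDeriv_chartField [IsManifold J 1 N] {ξ' : V → V}
    (hu : u ∈ (extChartAt J x₀).source) :
    chartDeriv J x₀ u (chartField J x₀ ξ' u) = ξ' (extChartAt J x₀ u) :=
  ((isInvertible_chartDeriv hu).inverse_apply_eq.1 rfl).symm

theorem eventuallyEq_chartField [IsManifold J 1 N] {ξ : (x : N) → TangentSpace J x}
    {ξ' : V → V} (hu : u ∈ (extChartAt J x₀).source)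
    (hξ : ∀ᶠ w in 𝓝 u, chartDeriv J x₀ w (ξ w) = ξ' (extChartAt J x₀ w)) :
    ξ =ᶠ[𝓝 u] chartField J x₀ ξ' := by
  filter_upwards [hξ, (isOpen_extChartAt_source x₀).mem_nhds hu] with w hw hws
  exact ((isInvertible_chartDeriv hws).inverse_apply_eq.2 hw.symm).symm

/-- Naturality of the bracket: near `u` both fields are pullbacks under the chart of their
coordinate expressions, and pullback commutes with brackets. -/
theorem chartDeriv_mlieBracket [IsManifold J 2 N] [CompleteSpace V]
    {ξ η : (x : N) → TangentSpace J x} {ξ' η' : V → V} (hu : u ∈ (extChartAt J x₀).source)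
    (hξ : ∀ᶠ w in 𝓝 u, chartDeriv J x₀ w (ξ w) = ξ' (extChartAt J x₀ w))
    (hη : ∀ᶠ w in 𝓝 u, chartDeriv J x₀ w (η w) = η' (extChartAt J x₀ w))
    (hξ' : DifferentiableAt ℝ ξ' (extChartAt J x₀ u))
    (hη' : DifferentiableAt ℝ η' (extChartAt J x₀ u)) :
    chartDeriv J x₀ u (mlieBracket J ξ η u) = lieBracket ℝ ξ' η' (extChartAt J x₀ u) := by
  have : IsManifold J 1 N := .of_le (n := 2) one_le_two
  have : IsManifold J (minSmoothness ℝ 2) N := by simpa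
  have : IsManifold 𝓘(ℝ, V) (minSmoothness ℝ 2) V := inferInstance
  have key : ∀ ζ : V → V, DifferentiableAt ℝ ζ (extChartAt J x₀ u) →
      MDifferentiableAt 𝓘(ℝ, V) 𝓘(ℝ, V).tangent (fun x ↦ (⟨x, ζ x⟩ : TangentBundle 𝓘(ℝ, V) V))
        (extChartAt J x₀ u) := by
    intro ζ h
    refine (mdifferentiableAt_section (E := TangentSpace 𝓘(ℝ, V)) 𝓘(ℝ, V)
      (fun x : V ↦ ζ x)).2 ?_
    simpa using! h.mdifferentiableAt
  have hb := mpullback_mlieBracket (I := J) (f := extChartAt J x₀) (x₀ := u) (n := 2)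
    (key ξ' hξ') (key η' hη') (contMDiffAt_extChartAt' (by simpa using hu)) (by simp)
  have he := (eventuallyEq_chartField hu hξ).mlieBracket_vectorField_eq
    (eventuallyEq_chartField hu hη)
  rw [he]
  have hl : mlieBracket 𝓘(ℝ, V) (fun x : V ↦ ξ' x) (fun x : V ↦ η' x) = lieBracket ℝ ξ' η' :=
    (mlieBracketWithin_eq_lieBracketWithin (s := univ)).trans lieBracketWithin_univ
  calc _ = chartDeriv J x₀ u (chartField J x₀
        (mlieBracket 𝓘(ℝ, V) (fun x : V ↦ ξ' x) (fun x : V ↦ η' x)) u) :=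
        congrArg (chartDeriv J x₀ u) hb.symm
    _ = _ := by rw [hl, chartDeriv_chartField hu]

theorem contMDiffAt_chartField [IsManifold J ∞ N] [CompleteSpace V] {ξ' : V → V}
    (hu : u ∈ (extChartAt J x₀).source) (hξ' : ContDiffAt ℝ ∞ ξ' (extChartAt J x₀ u)) :
    ContMDiffAt J J.tangent ∞ (fun x ↦ (⟨x, chartField J x₀ ξ' x⟩ : TangentBundle J N)) u := by
  have : IsManifold J 1 N := .of_le (n := ∞) (by simp)
  have key : ContMDiffAt 𝓘(ℝ, V) 𝓘(ℝ, V).tangent ∞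
      (fun x ↦ (⟨x, ξ' x⟩ : TangentBundle 𝓘(ℝ, V) V)) (extChartAt J x₀ u) :=
    contMDiffAt_vectorSpace_iff_contDiffAt.2 hξ'
  rw [← contMDiffWithinAt_univ] at key ⊢
  simpa using! ContMDiffWithinAt.mpullback_vectorField_preimage (n := ∞) (I := J)
    (f := extChartAt J x₀) key
    (contMDiffAt_extChartAt' (by simpa using hu)) (isInvertible_mfderiv_extChartAt hu) (by simp)

/-- `mextDeriv` uses a chart that varies with the point, while later computations keep one chart.
The two differ by pullback along the transition map, and `d` commutes with pullbacks. -/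
theorem mextDeriv_eq_of_chart [J.Boundaryless] [IsManifold J ∞ N] {k : ℕ}
    {α : (x : N) → TangentSpace J x [⋀^Fin k]→L[ℝ] ℝ} {α' : V → V [⋀^Fin k]→L[ℝ] ℝ}
    (hu : u ∈ (extChartAt J x₀).source)
    (hα : ∀ᶠ w in 𝓝 u, α w = (α' (extChartAt J x₀ w)).compContinuousLinearMap (chartDeriv J x₀ w))
    (hα' : DifferentiableAt ℝ α' (extChartAt J x₀ u)) :
    mextDeriv J α u =
      (extDeriv α' (extChartAt J x₀ u)).compContinuousLinearMap (chartDeriv J x₀ u) := by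
  have : IsManifold J 1 N := .of_le (n := ∞) (by simp)
  have hu' : extChartAt J u u ∈ (extChartAt J u).target := mem_extChartAt_target u
  set Ψ : V → V := extChartAt J x₀ ∘ (extChartAt J u).symm with hΨ
  have hsymm : ContinuousAt (extChartAt J u).symm (extChartAt J u u) :=
    continuousAt_extChartAt_symm u
  have hΨu : Ψ (extChartAt J u u) = extChartAt J x₀ u := by
    rw [hΨ, Function.comp_apply, extChartAt_to_inv]
  have hΨd : ∀ y ∈ (extChartAt J u).target, (extChartAt J u).symm y ∈ (extChartAt J x₀).source →
      (chartDeriv J x₀ ((extChartAt J u).symm y)).comp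
        (mfderiv 𝓘(ℝ, V) J (extChartAt J u).symm y) = fderiv ℝ Ψ y := by
    intro y hy hy'
    have hs : MDifferentiableAt 𝓘(ℝ, V) J (extChartAt J u).symm y :=
      (mdifferentiableOn_extChartAt_symm y hy).mdifferentiableAt
        ((isOpen_extChartAt_target u).mem_nhds hy)
    rw [← mfderiv_eq_fderiv]
    exact ((hasMFDerivAt_extChartAt_chartDeriv hy').comp y hs.hasMFDerivAt).mfderiv.symm
  have hcongr : (fun y : V ↦ (α ((extChartAt J u).symm y)).compContinuousLinearMap
      (mfderiv 𝓘(ℝ, V) J (extChartAt J u).symm y)) =ᶠ[𝓝 (extChartAt J u u)]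
      fun y ↦ (α' (Ψ y)).compContinuousLinearMap (fderiv ℝ Ψ y) := by
    have h1 := (isOpen_extChartAt_target u).mem_nhds hu'
    have h2 := hsymm.eventually (p := fun w ↦
      α w = (α' (extChartAt J x₀ w)).compContinuousLinearMap (chartDeriv J x₀ w) ∧
        w ∈ (extChartAt J x₀).source) (by
      rw [extChartAt_to_inv]
      exact hα.and ((isOpen_extChartAt_source x₀).mem_nhds hu))
    filter_upwards [h1, h2] with y h1 h2
    rw [h2.1, ← hΨd y h1 h2.2]
    rfl
  have hΨs : ContDiffAt ℝ ∞ Ψ (extChartAt J u u) := by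
    have := contDiffWithinAt_ext_coord_change (I := J) (n := ∞) x₀ u
      (y := extChartAt J u u) (by
        rw [PartialEquiv.trans_source]
        exact ⟨hu', by rwa [mem_preimage, extChartAt_to_inv]⟩)
    rwa [J.range_eq_univ, contDiffWithinAt_univ] at this
  have hpull := extDeriv_pullback (f := Ψ) (x := extChartAt J u u) (r := ∞)
    (by rwa [hΨu]) hΨs (by
      simpa using (ENat.LEInfty.out : (2 : ℕ∞ω) ≤ ∞))
  rw [mextDeriv]
  simp only [J.range_eq_univ, extDerivWithin_univ, mfderivWithin_univ]
  rw [hcongr.extDeriv_eq, hpull, hΨu]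
  have hD : (fderiv ℝ Ψ (extChartAt J u u)).comp (chartDeriv J u u) = chartDeriv J x₀ u := by
    ext s
    exact fderiv_chart_transition hu (mem_extChartAt_source u) s
  rw [← hD]
  rfl

end Charts

/-! ### Exterior powers of a 2-form as alternatizations. -/

section WedgePow

variable {V V' : Type*} [AddCommGroup V] [Module ℝ V] [AddCommGroup V'] [Module ℝ V']

theorem wedge_smul_smul {k l : ℕ} (c d : ℝ) (α : V [⋀^Fin k]→ₗ[ℝ] ℝ) (β : V [⋀^Fin l]→ₗ[ℝ] ℝ) :
    wedge (c • α) (d • β) = (c * d) • wedge α β := by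
  have h : (c • α).domCoprod (d • β) = (c * d) • α.domCoprod β := by
    rw [← AlternatingMap.domCoprod'_apply, ← AlternatingMap.domCoprod'_apply,
      TensorProduct.smul_tmul_smul, map_smul]
  ext v
  simp [wedge, h]

/-- The multilinear map `v ↦ ∏ᵢ α (v (2i), v (2i + 1))`, whose alternatization is a multiple of the
`m`-th exterior power of `α`. -/
noncomputable def pairProd (α : V [⋀^Fin 2]→ₗ[ℝ] ℝ) :
    (m : ℕ) → MultilinearMap ℝ (fun _ : Fin (2 * m) ↦ V) ℝ
  | 0 => MultilinearMap.constOfIsEmpty ℝ (fun _ : Fin 0 ↦ V) 1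
  | m + 1 => ((LinearMap.mul' ℝ ℝ).compMultilinearMap
      ((pairProd α m).domCoprod (α : MultilinearMap ℝ (fun _ : Fin 2 ↦ V) ℝ))).domDomCongr
        finSumFinEquiv

theorem pairProd_succ_apply (α : V [⋀^Fin 2]→ₗ[ℝ] ℝ) (m : ℕ) (v : Fin (2 * (m + 1)) → V) :
    pairProd α (m + 1) v =
      pairProd α m (fun i ↦ v (Fin.castAdd 2 i)) * α (fun i ↦ v (Fin.natAdd (2 * m) i)) := by
  simp only [pairProd, MultilinearMap.domDomCongr_apply, LinearMap.compMultilinearMap_apply,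
    MultilinearMap.domCoprod_apply, LinearMap.mul'_apply]
  rfl

theorem pairProd_apply (α : V [⋀^Fin 2]→ₗ[ℝ] ℝ) (m : ℕ) (v : Fin (2 * m) → V) :
    pairProd α m v = ∏ i : Fin m, α ![v ⟨2 * i, by omega⟩, v ⟨2 * i + 1, by omega⟩] := by
  induction m with
  | zero => simp [pairProd]
  | succ m ih =>
    rw [pairProd_succ_apply, ih, Fin.prod_univ_castSucc]
    congr 2
    ext i
    fin_cases i <;> rfl

theorem domDomCongr_alternatization {ι ι' : Type*} [Fintype ι] [Fintype ι'] [DecidableEq ι]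
    [DecidableEq ι'] (P : MultilinearMap ℝ (fun _ : ι ↦ V) ℝ) (e : ι ≃ ι') :
    (MultilinearMap.alternatization P).domDomCongr e =
      MultilinearMap.alternatization (P.domDomCongr e) := by
  ext v
  rw [AlternatingMap.domDomCongr_apply, MultilinearMap.alternatization_apply,
    MultilinearMap.alternatization_apply]
  refine Fintype.sum_equiv e.permCongr _ _ fun σ ↦ ?_
  simp [Equiv.Perm.sign_permCongr, MultilinearMap.domDomCongr_apply, Function.comp_def]

/-- Turns the recursive shuffle product into one explicit signed sum over permutations.
Alternatizing a form that is already alternating of degree 2 multiplies it by `2!`, once for each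
factor, whence the power of 2. -/
theorem smul_wedgePow_eq_alternatization (α : V [⋀^Fin 2]→ₗ[ℝ] ℝ) (m : ℕ) :
    (2 : ℝ) ^ m • wedgePow α m = MultilinearMap.alternatization (pairProd α m) := by
  induction m with
  | zero =>
    ext v
    simp [wedgePow, pairProd, MultilinearMap.alternatization_apply]
  | succ m ih =>
    have h2 : MultilinearMap.alternatization (α : MultilinearMap ℝ (fun _ : Fin 2 ↦ V) ℝ) =
        (2 : ℝ) • α := by
      rw [AlternatingMap.coe_alternatization]
      ext v
      simp
    have h : wedge ((2 : ℝ) ^ m • wedgePow α m) ((2 : ℝ) • α) =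
        MultilinearMap.alternatization (pairProd α (m + 1)) := by
      rw [wedge, ih, ← h2, ← MultilinearMap.domCoprod_alternization,
        ← LinearMap.compMultilinearMap_alternatization, domDomCongr_alternatization]
      rfl
    rw [← h, wedge_smul_smul, pow_succ]
    rfl

/-- In the signed sum for `2 ^ m • wedgePow` the map `A` enters each factor separately, so the sums
agree term by term; the power of 2 is then cancelled. -/
theorem wedgePow_compLinearMap (α : V' [⋀^Fin 2]→ₗ[ℝ] ℝ) (A : V →ₗ[ℝ] V') (m : ℕ) :
    wedgePow (α.compLinearMap A) m = (wedgePow α m).compLinearMap A := by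
  have key : (2 : ℝ) ^ m • wedgePow (α.compLinearMap A) m =
      (2 : ℝ) ^ m • (wedgePow α m).compLinearMap A := by
    have h := smul_wedgePow_eq_alternatization α m
    ext v
    have h' := DFunLike.congr_fun h (A ∘ v)
    rw [smul_wedgePow_eq_alternatization, MultilinearMap.alternatization_apply]
    rw [MultilinearMap.alternatization_apply] at h'
    refine Eq.trans ?_ h'.symm
    refine Finset.sum_congr rfl fun σ _ ↦ ?_
    rw [MultilinearMap.domDomCongr_apply, MultilinearMap.domDomCongr_apply, pairProd_apply,
      pairProd_apply]
    congr 1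
    refine Finset.prod_congr rfl fun i _ ↦ ?_
    rw [AlternatingMap.compLinearMap_apply]
    congr 1
    ext j
    fin_cases j <;> rfl
  exact smul_right_injective _ (by positivity) key

end WedgePow

/-! ### Determinant and trace acting on forms of top degree. -/

section TopDegree

variable {V : Type*} [AddCommGroup V] [Module ℝ V] {ι : Type*} [Fintype ι] [DecidableEq ι]

theorem compLinearMap_eq_det_smul (T : V [⋀^ι]→ₗ[ℝ] ℝ) (b : Module.Basis ι ℝ V) (A : V →ₗ[ℝ] V) :
    T.compLinearMap A = LinearMap.det A • T := by
  rw [AlternatingMap.eq_smul_basis_det b T]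
  ext v
  simp only [AlternatingMap.compLinearMap_apply, AlternatingMap.smul_apply, smul_eq_mul]
  have := b.det_comp A v
  rw [Function.comp_def] at this
  rw [this]
  ring

/-- Infinitesimal form of scaling by the determinant: on expanding `A (b i)` in the basis, the
off-diagonal terms repeat a basis vector and die. It makes the divergence appear in the Lie
derivative of a volume form. -/
theorem sum_update_eq_trace_mul (T : V [⋀^ι]→ₗ[ℝ] ℝ) (b : Module.Basis ι ℝ V) (A : V →ₗ[ℝ] V) :
    ∑ i, T (Function.update b i (A (b i))) = LinearMap.trace ℝ V A * T b := by
  rw [LinearMap.trace_eq_matrix_trace ℝ b, Matrix.trace, Finset.sum_mul]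
  refine Finset.sum_congr rfl fun i _ ↦ ?_
  rw [Matrix.diag_apply, LinearMap.toMatrix_apply]
  conv_lhs => rw [← b.sum_repr (A (b i))]
  rw [T.map_update_sum, Finset.sum_eq_single i]
  · rw [T.map_update_smul, Function.update_eq_self, smul_eq_mul]
  · intro j _ hj
    rw [T.map_update_smul, T.map_update_self _ hj.symm, smul_zero]
  · simp

end TopDegree

/-! ### Derivatives of determinants. -/

section Jacobi

/-- Jacobi's formula for the derivative of a determinant. -/
theorem hasFDerivAt_det {V : Type*} [NormedAddCommGroup V] [NormedSpace ℝ V] {ι : Type*} [Fintype ι]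
    [DecidableEq ι] {A : V → Matrix ι ι ℝ} {A' : ι → ι → V →L[ℝ] ℝ} {z : V}
    (hA : ∀ i j, HasFDerivAt (fun w ↦ A w i j) (A' i j) z) :
    ∃ D : V →L[ℝ] ℝ, HasFDerivAt (fun w ↦ (A w).det) D z ∧
      ∀ h, D h = ((A z).adjugate * Matrix.of fun i j ↦ A' i j h).trace := by
  have h1 : ∀ σ : Equiv.Perm ι, HasFDerivAt (fun w ↦ ∏ i, A w (σ i) i) _ z := fun σ ↦
    HasFDerivAt.finsetProd (u := Finset.univ) fun i _ ↦ hA (σ i) i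
  have h2 := HasFDerivAt.fun_sum (u := Finset.univ) fun σ _ ↦
    (h1 σ).const_mul (((Equiv.Perm.sign σ : ℤ)) : ℝ)
  refine ⟨_, h2.congr_of_eventuallyEq (.of_forall fun w ↦ Matrix.det_apply' _), fun h ↦ ?_⟩
  -- Cramer's rule: the diagonal entries of the product are determinants with one column
  -- differentiated, which is what the Leibniz formula yields column by column.
  have h3 : ∀ j, ((A z).adjugate * Matrix.of fun i j ↦ A' i j h) j j =
      ((A z).updateCol j fun i ↦ A' i j h).det := by
    intro j
    rw [← Matrix.cramer_apply, Matrix.cramer_eq_adjugate_mulVec]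
    rfl
  simp only [Matrix.trace, Matrix.diag_apply, h3, Matrix.det_apply',
    sum_apply, smul_apply, smul_eq_mul]
  rw [Finset.sum_comm]
  refine Finset.sum_congr rfl fun σ _ ↦ ?_
  rw [Finset.mul_sum]
  refine Finset.sum_congr rfl fun j _ ↦ ?_
  congr 1
  rw [← Finset.mul_prod_erase _ _ (Finset.mem_univ j), Matrix.updateCol_self, mul_comm]
  congr 1
  refine Finset.prod_congr rfl fun i hi ↦ ?_
  rw [Matrix.updateCol_ne (Finset.ne_of_mem_erase hi)]

/-- By Jacobi's formula and cyclicity of the trace, the adjugate meets `A z` and leaves its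
determinant. The shape `c A - P A - A Q` covers both uses: the matrix of `ω` along the spray (`c =
0`) and the matrix of `g` along a conformal lift. -/
theorem fderiv_det_of_eq {V : Type*} [NormedAddCommGroup V] [NormedSpace ℝ V] {ι : Type*}
    [Fintype ι] [DecidableEq ι] {A : V → Matrix ι ι ℝ} {z h : V} {P Q : Matrix ι ι ℝ} {c : ℝ}
    (hA : ∀ i j, DifferentiableAt ℝ (fun w ↦ A w i j) z)
    (hD : (Matrix.of fun i j ↦ fderiv ℝ (fun w ↦ A w i j) z h) = c • A z - P * A z - A z * Q) :
    fderiv ℝ (fun w ↦ (A w).det) z h =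
      (Fintype.card ι * c - P.trace - Q.trace) * (A z).det := by
  obtain ⟨D, hD1, hD2⟩ := hasFDerivAt_det fun i j ↦ (hA i j).hasFDerivAt
  rw [hD1.fderiv, hD2, hD, Matrix.mul_sub, Matrix.mul_sub, Matrix.trace_sub, Matrix.trace_sub,
    Matrix.mul_smul, Matrix.adjugate_mul, ← Matrix.mul_assoc, ← Matrix.mul_assoc,
    Matrix.adjugate_mul, Matrix.trace_mul_comm _ (A z), ← Matrix.mul_assoc, Matrix.mul_adjugate]
  simp
  ring

end Jacobi

/-! ### The top exterior power of the standard symplectic form is nonzero. -/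

section StandardSymplectic

variable {n : ℕ}

/-- The standard symplectic form `∑ᵢ dyⁱ ∧ dxⁱ` on `E × E`. -/
noncomputable def stdForm (n : ℕ) :
    (EuclideanSpace ℝ (Fin n) × EuclideanSpace ℝ (Fin n)) [⋀^Fin 2]→ₗ[ℝ] ℝ where
  toFun v := ∑ i, ((v 0).2 i * (v 1).1 i - (v 1).2 i * (v 0).1 i)
  map_update_add' v j x y := by
    have : j = 0 ∨ j = 1 := by omega
    rw [← Finset.sum_add_distrib]
    refine Finset.sum_congr rfl fun i _ ↦ ?_
    rcases this with rfl | rfl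
    · simp
      ring
    · simp
      ring
  map_update_smul' v j c x := by
    have : j = 0 ∨ j = 1 := by omega
    rw [smul_eq_mul, Finset.mul_sum]
    refine Finset.sum_congr rfl fun i _ ↦ ?_
    rcases this with rfl | rfl
    · simp
      ring
    · simp
      ring
  map_eq_zero_of_eq' v i j hij hne := by
    have h : v 0 = v 1 := by
      have : (i = 0 ∧ j = 1) ∨ (i = 1 ∧ j = 0) := by omega
      rcases this with ⟨rfl, rfl⟩ | ⟨rfl, rfl⟩
      exacts [hij, hij.symm]
    simp [h, mul_comm]

theorem stdForm_apply (a b : EuclideanSpace ℝ (Fin n) × EuclideanSpace ℝ (Fin n)) :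
    stdForm n ![a, b] = ∑ i, (a.2 i * b.1 i - b.2 i * a.1 i) := rfl

/-- The index of a pair `(i, s)` in the list of the `n` pairs `(2i, 2i + 1)`. -/
def pairEquiv (n : ℕ) : Fin n × Fin 2 ≃ Fin (2 * n) :=
  finProdFinEquiv.trans (finCongr (mul_comm n 2))

theorem pairEquiv_zero (i : Fin n) : pairEquiv n (i, 0) = ⟨2 * i, by omega⟩ := by
  ext; simp [pairEquiv]

theorem pairEquiv_one (i : Fin n) : pairEquiv n (i, 1) = ⟨2 * i + 1, by omega⟩ := by
  ext; simp [pairEquiv, add_comm]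

/-- No cancellation occurs in the signed sum. A term survives only if `σ` carries pairs to pairs;
then `σ` permutes the pairs by some `κ` and acts inside each by some `τ i`. As `κ` acts on two
copies its sign contributes a square, so the sign of `σ` is the product of the signs of the `τ i`.
This is also the value of the product of the `α`, and the term is a square. -/
theorem prod_pair_sign_nonneg (α : Fin n × Fin 2 → Fin n × Fin 2 → ℝ)
    (h : ∀ i j s t, α (i, s) (j, t) = if i = j then ((t : ℕ) : ℝ) - ((s : ℕ) : ℝ) else 0)
    (σ : Equiv.Perm (Fin n × Fin 2)) :
    0 ≤ ((Equiv.Perm.sign σ : ℤ) : ℝ) * ∏ i, α (σ (i, 0)) (σ (i, 1)) := by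
  by_cases hσ : ∀ i, (σ (i, 0)).1 = (σ (i, 1)).1
  · have hfst : ∀ i s, (σ (i, s)).1 = (σ (i, 0)).1 := by
      intro i s
      fin_cases s
      exacts [rfl, (hσ i).symm]
    have hκ : Function.Bijective fun i ↦ (σ (i, 0)).1 := by
      refine Function.Surjective.bijective_of_finite fun k ↦ ⟨(σ.symm (k, 0)).1, ?_⟩
      have := hfst (σ.symm (k, 0)).1 (σ.symm (k, 0)).2
      rw [Prod.mk.eta, Equiv.apply_symm_apply] at this
      exact this.symm
    have hτ : ∀ i, Function.Bijective fun s ↦ (σ (i, s)).2 := by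
      refine fun i ↦ Function.Injective.bijective_of_finite fun s t hst ↦ ?_
      have : σ (i, s) = σ (i, t) := Prod.ext ((hfst i s).trans (hfst i t).symm) hst
      exact (Prod.ext_iff.1 (σ.injective this)).2
    set κ : Equiv.Perm (Fin n) := Equiv.ofBijective _ hκ
    set τ : Fin n → Equiv.Perm (Fin 2) := fun i ↦ Equiv.ofBijective _ (hτ i)
    have hσ' : σ = Equiv.prodCongrLeft (fun _ : Fin 2 ↦ κ) * Equiv.prodCongrRight τ := by
      ext1 x
      exact Prod.ext (hfst x.1 x.2) rfl
    have hsgn : Equiv.Perm.sign σ = ∏ i, Equiv.Perm.sign (τ i) := by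
      rw [hσ', Equiv.Perm.sign_mul, Equiv.Perm.sign_prodCongrLeft, Equiv.Perm.sign_prodCongrRight]
      simp
    have hpair : ∀ ρ : Equiv.Perm (Fin 2),
        ((ρ 1 : ℕ) : ℤ) - ((ρ 0 : ℕ) : ℤ) = Equiv.Perm.sign ρ := by decide
    have hval : ∀ i, α (σ (i, 0)) (σ (i, 1)) = ((Equiv.Perm.sign (τ i) : ℤ) : ℝ) := by
      intro i
      rw [← Prod.mk.eta (p := σ (i, 0)), ← Prod.mk.eta (p := σ (i, 1)), h, if_pos (hσ i),
        ← hpair]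
      push_cast
      rfl
    rw [Finset.prod_congr rfl fun i _ ↦ hval i, hsgn]
    push_cast
    exact mul_self_nonneg _
  · push Not at hσ
    obtain ⟨i, hi⟩ := hσ
    have : α (σ (i, 0)) (σ (i, 1)) = 0 := by
      rw [← Prod.mk.eta (p := σ (i, 0)), ← Prod.mk.eta (p := σ (i, 1)), h, if_neg hi]
    rw [Finset.prod_eq_zero (Finset.mem_univ i) this, mul_zero]

/-- All terms of the signed sum are nonnegative and the identity permutation contributes 1. -/
theorem wedgePow_ne_zero_of_pairs {V : Type*} [AddCommGroup V] [Module ℝ V]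
    (α : V [⋀^Fin 2]→ₗ[ℝ] ℝ) (b : Fin n × Fin 2 → V)
    (h : ∀ i j s t, α ![b (i, s), b (j, t)] = if i = j then ((t : ℕ) : ℝ) - ((s : ℕ) : ℝ) else 0) :
    wedgePow α n (fun k ↦ b ((pairEquiv n).symm k)) ≠ 0 := by
  have h1 := DFunLike.congr_fun (smul_wedgePow_eq_alternatization α n)
    (fun k ↦ b ((pairEquiv n).symm k))
  rw [AlternatingMap.smul_apply, MultilinearMap.alternatization_apply] at h1
  have h2 : ∑ σ : Equiv.Perm (Fin (2 * n)), Equiv.Perm.sign σ •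
      (pairProd α n).domDomCongr σ (fun k ↦ b ((pairEquiv n).symm k)) =
      ∑ σ : Equiv.Perm (Fin n × Fin 2), ((Equiv.Perm.sign σ : ℤ) : ℝ) *
        ∏ i, α ![b (σ (i, 0)), b (σ (i, 1))] := by
    refine (Fintype.sum_equiv (pairEquiv n).permCongr _ _ fun σ ↦ ?_).symm
    rw [MultilinearMap.domDomCongr_apply, pairProd_apply, Equiv.Perm.sign_permCongr]
    simp only [← pairEquiv_zero, ← pairEquiv_one]
    simp [Units.smul_def]
  have h3 : 0 < ∑ σ : Equiv.Perm (Fin n × Fin 2), ((Equiv.Perm.sign σ : ℤ) : ℝ) *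
        ∏ i, α ![b (σ (i, 0)), b (σ (i, 1))] := by
    refine Finset.sum_pos' (fun σ _ ↦ prod_pair_sign_nonneg (fun x y ↦ α ![b x, b y]) h σ)
      ⟨1, Finset.mem_univ _, ?_⟩
    simp [h]
  intro h0
  rw [h0] at h1
  rw [← h2, ← h1] at h3
  simp at h3

theorem exists_basis_wedgePow_stdForm_ne_zero (n : ℕ) :
    ∃ b : Module.Basis (Fin (2 * n)) ℝ (EuclideanSpace ℝ (Fin n) × EuclideanSpace ℝ (Fin n)),
      wedgePow (stdForm n) n b ≠ 0 := by
  set c := (EuclideanSpace.basisFun (Fin n) ℝ).toBasis with hc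
  have hci : ∀ i j, c i j = if i = j then (1 : ℝ) else 0 := by
    intro i j
    simp [hc, PiLp.single_apply, eq_comm]
  -- Velocity vectors take slot 0 and position vectors slot 1, since `stdForm` pairs a velocity with
  -- a position, in this order, to `+1`.
  let f : Fin n ⊕ Fin n ≃ Fin n × Fin 2 :=
    { toFun := Sum.elim (fun i ↦ (i, 1)) (fun i ↦ (i, 0))
      invFun := fun x ↦ if x.2 = 0 then Sum.inr x.1 else Sum.inl x.1
      left_inv := by rintro (i | i) <;> simp
      right_inv := by
        rintro ⟨i, s⟩
        fin_cases s <;> simp }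
  refine ⟨((c.prod c).reindex f).reindex (pairEquiv n), ?_⟩
  have h0 : ∀ i, (c.prod c).reindex f (i, 0) = (0, c i) := fun i ↦ by
    rw [Module.Basis.reindex_apply]
    exact Prod.ext (by simp [f]) (by simp [f])
  have h1 : ∀ i, (c.prod c).reindex f (i, 1) = (c i, 0) := fun i ↦ by
    rw [Module.Basis.reindex_apply]
    exact Prod.ext (by simp [f]) (by simp [f])
  have h := wedgePow_ne_zero_of_pairs (stdForm n) ((c.prod c).reindex f) ?_
  · rwa [Module.Basis.coe_reindex]
  · intro i j s t
    rw [stdForm_apply]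
    fin_cases s <;> fin_cases t <;> simp [h0, h1, hci, eq_comm]
    split_ifs <;> simp

end StandardSymplectic

/-! ### Hamiltonian fields and weighted divergence on a vector space. -/

section Calculus

variable {V : Type*} [NormedAddCommGroup V] [NormedSpace ℝ V]

/-- The exterior derivative of a 1-form on a vector space, as a bilinear form. -/
noncomputable def dForm (θ : V → V →L[ℝ] ℝ) (z : V) : V →L[ℝ] V →L[ℝ] ℝ :=
  fderiv ℝ θ z - (fderiv ℝ θ z).flip

theorem dForm_apply (θ : V → V →L[ℝ] ℝ) (z a b : V) :
    dForm θ z a b = fderiv ℝ θ z a b - fderiv ℝ θ z b a := rfl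

theorem differentiableAt_fderiv {W : Type*} [NormedAddCommGroup W] [NormedSpace ℝ W] {f : V → W}
    {z : V} (hf : ContDiffAt ℝ 2 f z) : DifferentiableAt ℝ (fderiv ℝ f) z :=
  (hf.fderiv_right (m := 1) (by rw [one_add_one_eq_two])).differentiableAt one_ne_zero

theorem fderiv_dForm_apply {θ : V → V →L[ℝ] ℝ} {z : V} (hθ : ContDiffAt ℝ 2 θ z) (a b h : V) :
    DifferentiableAt ℝ (fun w ↦ dForm θ w a b) z ∧ fderiv ℝ (fun w ↦ dForm θ w a b) z h =
      fderiv ℝ (fderiv ℝ θ) z h a b - fderiv ℝ (fderiv ℝ θ) z h b a := by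
  have h0 := (differentiableAt_fderiv hθ).hasFDerivAt
  have h1 : ∀ x y, HasFDerivAt (fun w ↦ fderiv ℝ θ w x y)
      (((fderiv ℝ (fderiv ℝ θ) z).flip x).flip y) z := fun x y ↦ by
    simpa using! (h0.clm_apply (hasFDerivAt_const x z)).clm_apply (hasFDerivAt_const y z)
  have h2 : HasFDerivAt (fun w ↦ dForm θ w a b) _ z := (h1 a b).sub (h1 b a)
  exact ⟨h2.differentiableAt, by rw [h2.fderiv]; rfl⟩

/-- A vector field `S` with `i_S dθ = -de` preserves `dθ`. -/
theorem fderiv_dForm_apply_of_hamiltonian {θ : V → V →L[ℝ] ℝ} {e : V → ℝ} {S : V → V} {z : V}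
    (hθ : ContDiffAt ℝ 2 θ z) (he : ContDiffAt ℝ 2 e z) (hS : DifferentiableAt ℝ S z)
    (h : ∀ᶠ w in 𝓝 z, dForm θ w (S w) = -fderiv ℝ e w) (a b : V) :
    fderiv ℝ (fun w ↦ dForm θ w a b) z (S z) =
      -dForm θ z (fderiv ℝ S z a) b - dForm θ z a (fderiv ℝ S z b) := by
  have h0 := (differentiableAt_fderiv hθ).hasFDerivAt
  -- The identity `i_S dθ = -de`, evaluated on `y` and differentiated along `x`. Antisymmetrizing in
  -- `x` and `y` removes the symmetric Hessian of `e`; this is `L_S dθ = d i_S dθ = -dde = 0` by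
  -- hand.
  have key : ∀ x y, fderiv ℝ (fderiv ℝ θ) z x (S z) y + fderiv ℝ θ z (fderiv ℝ S z x) y -
      (fderiv ℝ (fderiv ℝ θ) z x y (S z) + fderiv ℝ θ z y (fderiv ℝ S z x)) =
        -fderiv ℝ (fderiv ℝ e) z x y := by
    intro x y
    have h1 := (h0.clm_apply hS.hasFDerivAt).clm_apply (hasFDerivAt_const y z)
    have h2 := (h0.clm_apply (hasFDerivAt_const y z)).clm_apply hS.hasFDerivAt
    have h3 := (differentiableAt_fderiv he).hasFDerivAt.clm_apply (hasFDerivAt_const y z)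
    have h4 := (h1.sub h2).unique (h3.neg.congr_of_eventuallyEq
      (h.mono fun w hw ↦ DFunLike.congr_fun hw y))
    have h5 := DFunLike.congr_fun h4 x
    simp at h5
    linarith
  have hs1 : IsSymmSndFDerivAt ℝ θ z := hθ.isSymmSndFDerivAt (by simp)
  have hs2 : IsSymmSndFDerivAt ℝ e z := he.isSymmSndFDerivAt (by simp)
  have hab := key a b
  have hba := key b a
  rw [(fderiv_dForm_apply hθ a b (S z)).2]
  simp only [dForm_apply]
  rw [hs2.eq b a, hs1.eq b a] at hba
  rw [hs1.eq (S z) a, hs1.eq (S z) b]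
  linarith

set_option synthInstance.maxHeartbeats 400000 in
theorem contDiffAt_dForm {θ : V → V →L[ℝ] ℝ} {z : V} (hθ : ContDiffAt ℝ ∞ θ z) :
    ContDiffAt ℝ ∞ (dForm θ) z := by
  have h0 := hθ.fderiv_right (m := ∞) (by simp)
  have h1 : ContDiff ℝ ∞ fun A : V →L[ℝ] V →L[ℝ] ℝ ↦ A.flip :=
    IsBoundedLinearMap.contDiff ⟨⟨fun _ _ ↦ rfl, fun _ _ ↦ rfl⟩, 1, one_pos, fun A ↦ by
      rw [ContinuousLinearMap.opNorm_flip, one_mul]⟩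
  exact h0.sub (h1.contDiffAt.comp z h0)

set_option synthInstance.maxHeartbeats 400000 in
theorem contDiffAt_inverse_apply {W : Type*} [NormedAddCommGroup W] [NormedSpace ℝ W]
    [CompleteSpace V] {A : V → V →L[ℝ] W} {b : V → W} {z : V} (hA : ContDiffAt ℝ ∞ A z)
    (hb : ContDiffAt ℝ ∞ b z) (hi : (A z).IsInvertible) :
    ContDiffAt ℝ ∞ (fun w ↦ (A w).inverse (b w)) z := by
  obtain ⟨B, hB⟩ := hi
  have h1 : ContDiffAt ℝ ∞ (ContinuousLinearMap.inverse : (V →L[ℝ] W) → W →L[ℝ] V) (A z) := by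
    rw [← hB]
    exact contDiffAt_map_inverse B
  exact (h1.comp z hA).clm_apply hb
variable [FiniteDimensional ℝ V]

variable (V) in
/-- The trace as a continuous linear functional. -/
noncomputable def traceL : (V →L[ℝ] V) →L[ℝ] ℝ :=
  LinearMap.toContinuousLinearMap
    ((LinearMap.trace ℝ V).comp (ContinuousLinearMap.coeLM ℝ))

theorem traceL_apply (A : V →L[ℝ] V) : traceL V A = LinearMap.trace ℝ V A := rfl

theorem traceL_comp_comm (A B : V →L[ℝ] V) : traceL V (A.comp B) = traceL V (B.comp A) :=
  LinearMap.trace_mul_comm ℝ (A : V →ₗ[ℝ] V) (B : V →ₗ[ℝ] V)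

/-- The divergence of `δ ξ`, where `δ` is a density. -/
noncomputable def densityDiv (δ : V → ℝ) (ξ : V → V) (z : V) : ℝ :=
  fderiv ℝ δ z (ξ z) + δ z * traceL V (fderiv ℝ ξ z)

theorem hasFDerivAt_densityDiv {δ : V → ℝ} {ξ : V → V} {z : V} (hδ : ContDiffAt ℝ 2 δ z)
    (hξ : ContDiffAt ℝ 2 ξ z) :
    ∃ D : V →L[ℝ] ℝ, HasFDerivAt (densityDiv δ ξ) D z ∧ ∀ h, D h =
      fderiv ℝ (fderiv ℝ δ) z h (ξ z) + fderiv ℝ δ z (fderiv ℝ ξ z h) +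
        (fderiv ℝ δ z h * traceL V (fderiv ℝ ξ z) +
          δ z * traceL V (fderiv ℝ (fderiv ℝ ξ) z h)) := by
  have h1 := (differentiableAt_fderiv hδ).hasFDerivAt.clm_apply
    (hξ.differentiableAt two_ne_zero).hasFDerivAt
  have h2 := (hδ.differentiableAt two_ne_zero).hasFDerivAt.mul
    ((traceL V).hasFDerivAt.comp z (differentiableAt_fderiv hξ).hasFDerivAt)
  refine ⟨_, h1.add h2, fun h ↦ ?_⟩
  simp
  ring

/-- The rule `div [ξ, η] = ξ (div η) - η (div ξ)` in weighted form: the two vanishing divergences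
are differentiated along the other field and subtracted. The traces of the two products of Jacobians
cancel by cyclicity. -/
theorem densityDiv_lieBracket {δ : V → ℝ} {ξ η : V → V} {z : V} (hδ : ContDiffAt ℝ 2 δ z)
    (hξ : ContDiffAt ℝ 2 ξ z) (hη : ContDiffAt ℝ 2 η z)
    (h₁ : ∀ᶠ w in 𝓝 z, densityDiv δ ξ w = 0) (h₂ : ∀ᶠ w in 𝓝 z, densityDiv δ η w = 0) :
    densityDiv δ (lieBracket ℝ ξ η) z = 0 := by
  obtain ⟨D₁, hD₁, hD₁'⟩ := hasFDerivAt_densityDiv hδ hξ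
  obtain ⟨D₂, hD₂, hD₂'⟩ := hasFDerivAt_densityDiv hδ hη
  have e₁ := hD₁.unique ((hasFDerivAt_const (0 : ℝ) z).congr_of_eventuallyEq h₁)
  have e₂ := hD₂.unique ((hasFDerivAt_const (0 : ℝ) z).congr_of_eventuallyEq h₂)
  have f₁ := hD₁' (η z)
  have f₂ := hD₂' (ξ z)
  rw [e₁] at f₁
  rw [e₂] at f₂
  have g₁ := h₁.self_of_nhds
  have g₂ := h₂.self_of_nhds
  have hξ1 := (hξ.differentiableAt two_ne_zero).hasFDerivAt
  have hη1 := (hη.differentiableAt two_ne_zero).hasFDerivAt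
  have hb : HasFDerivAt (lieBracket ℝ ξ η) _ z :=
    ((differentiableAt_fderiv hη).hasFDerivAt.clm_apply hξ1).sub
      ((differentiableAt_fderiv hξ).hasFDerivAt.clm_apply hη1)
  have hs1 : IsSymmSndFDerivAt ℝ ξ z := hξ.isSymmSndFDerivAt (by simp)
  have hs2 : IsSymmSndFDerivAt ℝ η z := hη.isSymmSndFDerivAt (by simp)
  have hs3 : IsSymmSndFDerivAt ℝ δ z := hδ.isSymmSndFDerivAt (by simp)
  -- The Jacobian of the bracket contains second derivatives with flipped arguments; symmetry gives
  -- them the form they have in the derivatives of the divergences.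
  have k₁ : (fderiv ℝ (fderiv ℝ η) z).flip (ξ z) = fderiv ℝ (fderiv ℝ η) z (ξ z) := by
    ext x
    exact hs2.eq _ _
  have k₂ : (fderiv ℝ (fderiv ℝ ξ) z).flip (η z) = fderiv ℝ (fderiv ℝ ξ) z (η z) := by
    ext x
    exact hs1.eq _ _
  rw [densityDiv, hb.fderiv, k₁, k₂]
  simp only [map_add, map_sub, traceL_comp_comm (fderiv ℝ η z), lieBracket]
  simp only [densityDiv] at g₁ g₂
  simp only [zero_apply] at f₁ f₂
  rw [hs3.eq (η z)] at f₁
  linear_combination f₁ - f₂ - traceL V (fderiv ℝ η z) * g₁ + traceL V (fderiv ℝ ξ z) * g₂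

end Calculus

/-! ### Energy, fundamental form and spray in coordinates. -/

section Phase

variable {n : ℕ}

/-- The coordinate space of `TM`: pairs (position, velocity). -/
abbrev Phase (n : ℕ) := EuclideanSpace ℝ (Fin n) × EuclideanSpace ℝ (Fin n)

/-- The vertical endomorphism `(x, y) ↦ (0, x)`. -/
noncomputable def vertEnd (n : ℕ) : Phase n →L[ℝ] Phase n :=
  (ContinuousLinearMap.inr ℝ (EuclideanSpace ℝ (Fin n)) (EuclideanSpace ℝ (Fin n))).comp
    (ContinuousLinearMap.fst ℝ (EuclideanSpace ℝ (Fin n)) (EuclideanSpace ℝ (Fin n)))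

theorem vertEnd_apply (a : Phase n) : vertEnd n a = (0, a.1) := rfl

/-- The standard basis of `E × E`. -/
noncomputable def phaseBasis (n : ℕ) : Module.Basis (Fin n ⊕ Fin n) ℝ (Phase n) :=
  (EuclideanSpace.basisFun (Fin n) ℝ).toBasis.prod (EuclideanSpace.basisFun (Fin n) ℝ).toBasis

/-- The Hilbert form `dε ∘ J` of an energy function `ε` on `E × E`. -/
noncomputable def hilbertCoord (ε : Phase n → ℝ) (z : Phase n) : Phase n →L[ℝ] ℝ :=
  (fderiv ℝ ε z).comp (vertEnd n)

/-- The matrix of vertical second derivatives of an energy function on `E × E`. -/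
noncomputable def gram (ε : Phase n → ℝ) (z : Phase n) : Matrix (Fin n) (Fin n) ℝ :=
  Matrix.of fun i j ↦ fderiv ℝ (fderiv ℝ ε) z (0, EuclideanSpace.basisFun (Fin n) ℝ i)
    (0, EuclideanSpace.basisFun (Fin n) ℝ j)

variable {ε : Phase n → ℝ} {z : Phase n}

theorem fderiv_hilbertCoord (hε : ContDiffAt ℝ 2 ε z) (a b : Phase n) :
    fderiv ℝ (hilbertCoord ε) z a b = fderiv ℝ (fderiv ℝ ε) z a (0, b.1) := by
  have h := (differentiableAt_fderiv hε).hasFDerivAt.clm_comp (hasFDerivAt_const (vertEnd n) z)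
  change fderiv ℝ (fun w ↦ (fderiv ℝ ε w).comp (vertEnd n)) z a b = _
  rw [h.fderiv]
  simp [vertEnd_apply]

theorem contDiffAt_hilbertCoord {m : ℕ∞ω} {k : ℕ∞ω} (hε : ContDiffAt ℝ k ε z) (hk : m + 1 ≤ k) :
    ContDiffAt ℝ m (hilbertCoord ε) z :=
  (hε.fderiv_right hk).clm_comp contDiffAt_const

theorem dForm_hilbertCoord (hε : ContDiffAt ℝ 2 ε z) (a b : Phase n) :
    dForm (hilbertCoord ε) z a b =
      fderiv ℝ (fderiv ℝ ε) z a (0, b.1) - fderiv ℝ (fderiv ℝ ε) z b (0, a.1) := by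
  rw [dForm_apply, fderiv_hilbertCoord hε, fderiv_hilbertCoord hε]

/-- The derivative of the Legendre transformation `(x, y) ↦ (x, ∂ε/∂y)`. -/
noncomputable def legendre (ε : Phase n → ℝ) (z : Phase n) : Phase n →ₗ[ℝ] Phase n where
  toFun a := (a.1, WithLp.toLp 2 fun i ↦
    fderiv ℝ (fderiv ℝ ε) z a (0, EuclideanSpace.basisFun (Fin n) ℝ i))
  map_add' a b := by
    refine Prod.ext rfl ?_
    ext i
    simp
  map_smul' c a := by
    refine Prod.ext rfl ?_
    ext i
    simp

theorem apply_vert_eq_sum (f : Phase n →L[ℝ] ℝ) (v : EuclideanSpace ℝ (Fin n)) :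
    f (0, v) = ∑ i, f (0, EuclideanSpace.basisFun (Fin n) ℝ i) * v i := by
  have h1 : ∀ w, f (0, w) = f.comp (ContinuousLinearMap.inr ℝ (EuclideanSpace ℝ (Fin n))
    (EuclideanSpace ℝ (Fin n))) w := fun _ ↦ rfl
  have h2 : v = ∑ i, v i • EuclideanSpace.basisFun (Fin n) ℝ i :=
    ((EuclideanSpace.basisFun (Fin n) ℝ).sum_repr v).symm
  rw [h1]
  conv_lhs => rw [h2]
  rw [map_sum]
  refine Finset.sum_congr rfl fun i _ ↦ ?_
  rw [map_smul, h1, smul_eq_mul, mul_comm]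

/-- The Hilbert form is `∑ pᵢ dxⁱ` with `pᵢ = ∂ε/∂yⁱ`, so its differential is `∑ dpᵢ ∧ dxⁱ`. -/
theorem dForm_eq_stdForm_legendre (hε : ContDiffAt ℝ 2 ε z) (a b : Phase n) :
    dForm (hilbertCoord ε) z a b = stdForm n ![legendre ε z a, legendre ε z b] := by
  rw [dForm_hilbertCoord hε, stdForm_apply, apply_vert_eq_sum, apply_vert_eq_sum,
    ← Finset.sum_sub_distrib]
  rfl

/-- Positions are left unchanged, so the matrix is block triangular with diagonal blocks `1` and the
transposed Gram matrix. -/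
theorem det_legendre : LinearMap.det (legendre ε z) = (gram ε z).det := by
  rw [← LinearMap.det_toMatrix (phaseBasis n), ← Matrix.det_transpose (gram ε z)]
  have h : LinearMap.toMatrix (phaseBasis n) (phaseBasis n) (legendre ε z) =
      Matrix.fromBlocks 1 0 (Matrix.of fun i j ↦ fderiv ℝ (fderiv ℝ ε) z
        (EuclideanSpace.basisFun (Fin n) ℝ j, 0) (0, EuclideanSpace.basisFun (Fin n) ℝ i))
        (gram ε z).transpose := by
    ext i j
    rw [LinearMap.toMatrix_apply]
    rcases i with i | i <;> rcases j with j | j <;>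
      simp [phaseBasis, legendre, gram, Matrix.one_apply, PiLp.single_apply]
  rw [h, Matrix.det_fromBlocks_zero₁₂, Matrix.det_one, one_mul]

/-- The matrix of `d(dε ∘ J)`. -/
noncomputable def formMatrix (ε : Phase n → ℝ) (z : Phase n) :
    Matrix (Fin n ⊕ Fin n) (Fin n ⊕ Fin n) ℝ :=
  Matrix.of fun i j ↦ dForm (hilbertCoord ε) z (phaseBasis n i) (phaseBasis n j)

/-- Two vertical vectors pair to zero under the form, so its matrix has a zero block. Multiplying on
the right by the constant symplectic matrix makes it block triangular with diagonal blocks `gᵀ` and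
`g`. The constant `c` is the determinant of that symplectic matrix, whose sign is never needed. -/
theorem det_formMatrix (n : ℕ) : ∃ c : ℝ, c ≠ 0 ∧ ∀ (ε : Phase n → ℝ) (z : Phase n),
    ContDiffAt ℝ 2 ε z → (formMatrix ε z).det * c = (gram ε z).det ^ 2 := by
  refine ⟨(Matrix.fromBlocks 0 1 (-1) 0 : Matrix (Fin n ⊕ Fin n) (Fin n ⊕ Fin n) ℝ).det, ?_,
    fun ε z hε ↦ ?_⟩
  · refine right_ne_zero_of_mul
      (a := (Matrix.fromBlocks 0 (-1) 1 0 : Matrix (Fin n ⊕ Fin n) (Fin n ⊕ Fin n) ℝ).det) ?_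
    rw [← Matrix.det_mul, Matrix.fromBlocks_multiply]
    simp
  · have h : formMatrix ε z = Matrix.fromBlocks
        (Matrix.of fun i j ↦ dForm (hilbertCoord ε) z (phaseBasis n (Sum.inl i))
          (phaseBasis n (Sum.inl j))) (-(gram ε z).transpose) (gram ε z) 0 := by
      have h0 : ∀ f : Phase n →L[ℝ] ℝ, f (0, 0) = 0 := fun f ↦ map_zero f
      ext i j
      rcases i with i | i <;> rcases j with j | j
      · rfl
      all_goals
        simp [formMatrix, dForm_hilbertCoord hε, phaseBasis, gram, h0]
    rw [← Matrix.det_mul, h, Matrix.fromBlocks_multiply]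
    simp [sq]

theorem dForm_nondegenerate (hε : ContDiffAt ℝ 2 ε z) (hdet : (gram ε z).det ≠ 0) {a : Phase n}
    (h : ∀ b, dForm (hilbertCoord ε) z a b = 0) : a = 0 := by
  obtain ⟨c, hc, hc'⟩ := det_formMatrix n
  have hd : (formMatrix ε z).det ≠ 0 :=
    left_ne_zero_of_mul (b := c) (by rw [hc' ε z hε]; exact pow_ne_zero _ hdet)
  have h0 : Matrix.vecMul ((phaseBasis n).repr a) (formMatrix ε z) = 0 := by
    ext j
    have := h (phaseBasis n j)
    rw [← (phaseBasis n).sum_repr a, map_sum] at this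
    simpa [Matrix.vecMul, dotProduct, formMatrix] using this
  have h1 := Matrix.eq_zero_of_vecMul_eq_zero hd h0
  rw [← (phaseBasis n).sum_repr a]
  simp [h1]

/-- The Hamiltonian vector field of `ε`, the coordinate form of the canonical spray. -/
noncomputable def sprayCoord (ε : Phase n → ℝ) (z : Phase n) : Phase n :=
  (dForm (hilbertCoord ε) z).inverse (-fderiv ℝ ε z)

theorem isInvertible_dForm (hε : ContDiffAt ℝ 2 ε z) (hdet : (gram ε z).det ≠ 0) :
    (dForm (hilbertCoord ε) z).IsInvertible := by
  have hinj : Function.Injective (dForm (hilbertCoord ε) z : Phase n →ₗ[ℝ] Phase n →L[ℝ] ℝ) := by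
    rw [injective_iff_map_eq_zero]
    exact fun a ha ↦ dForm_nondegenerate hε hdet fun b ↦ DFunLike.congr_fun ha b
  have hrank : Module.finrank ℝ (Phase n) = Module.finrank ℝ (Phase n →L[ℝ] ℝ) := by
    rw [← (LinearMap.toContinuousLinearMap (𝕜 := ℝ) (E := Phase n) (F' := ℝ)).finrank_eq]
    exact (Subspace.dual_finrank_eq (K := ℝ) (V := Phase n)).symm
  exact ⟨(LinearEquiv.ofInjectiveOfFinrankEq _ hinj hrank).toContinuousLinearEquiv, rfl⟩

theorem dForm_sprayCoord (hε : ContDiffAt ℝ 2 ε z) (hdet : (gram ε z).det ≠ 0) :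
    dForm (hilbertCoord ε) z (sprayCoord ε z) = -fderiv ℝ ε z :=
  ((isInvertible_dForm hε hdet).inverse_apply_eq.1 rfl).symm

theorem contDiffAt_sprayCoord (hε : ContDiffAt ℝ ∞ ε z) (hdet : (gram ε z).det ≠ 0) :
    ContDiffAt ℝ ∞ (sprayCoord ε) z := by
  have hθ : ContDiffAt ℝ ∞ (hilbertCoord ε) z := contDiffAt_hilbertCoord hε (by simp)
  exact contDiffAt_inverse_apply (contDiffAt_dForm hθ) (hε.fderiv_right (m := ∞) (by simp)).neg
    (isInvertible_dForm (hε.of_le ENat.LEInfty.out) hdet)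

theorem contDiffAt_gram_apply (hε : ContDiffAt ℝ ∞ ε z) (i j : Fin n) :
    ContDiffAt ℝ ∞ (fun w ↦ gram ε w i j) z :=
  (((hε.fderiv_right (m := ∞) (by simp)).fderiv_right (m := ∞) (by simp)).clm_apply
    contDiffAt_const).clm_apply contDiffAt_const

theorem contDiffAt_det_gram (hε : ContDiffAt ℝ ∞ ε z) :
    ContDiffAt ℝ ∞ (fun w ↦ (gram ε w).det) z := by
  simp only [Matrix.det_apply']
  exact ContDiffAt.sum fun σ _ ↦ contDiffAt_const.mul
    (contDiffAt_prod fun i _ ↦ contDiffAt_gram_apply hε _ _)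

/-- The spray preserves the density `det g`. -/
theorem densityDiv_sprayCoord (hε : ContDiffAt ℝ ∞ ε z) (hdet : (gram ε z).det ≠ 0) :
    densityDiv (fun w ↦ (gram ε w).det) (sprayCoord ε) z = 0 := by
  obtain ⟨c, hc, hc'⟩ := det_formMatrix n
  have hε2 : ∀ᶠ w in 𝓝 z, ContDiffAt ℝ 2 ε w :=
    (hε.of_le ENat.LEInfty.out).eventually (by simp)
  have hδ := (contDiffAt_det_gram hε).differentiableAt (by simp)
  have hθ : ContDiffAt ℝ 2 (hilbertCoord ε) z :=
    (contDiffAt_hilbertCoord (m := ∞) hε (by simp)).of_le ENat.LEInfty.out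
  have hS := (contDiffAt_sprayCoord hε hdet).differentiableAt (by simp)
  have hham : ∀ᶠ w in 𝓝 z, dForm (hilbertCoord ε) w (sprayCoord ε w) = -fderiv ℝ ε w := by
    filter_upwards [hε2, hδ.continuousAt.eventually_ne hdet] with w h1 h2
    exact dForm_sprayCoord h1 h2
  set A := LinearMap.toMatrix (phaseBasis n) (phaseBasis n)
    (fderiv ℝ (sprayCoord ε) z : Phase n →ₗ[ℝ] Phase n) with hA
  have hrep : ∀ i, fderiv ℝ (sprayCoord ε) z (phaseBasis n i) =
      ∑ k, A k i • phaseBasis n k := fun i ↦ by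
    simp only [hA, LinearMap.toMatrix_apply]
    exact ((phaseBasis n).sum_repr _).symm
  -- Invariance of the form along the spray, in matrices: its matrix `W` has derivative `-Aᵀ W - W
  -- A`, so `det W` has derivative `-2 tr A · det W`.
  have h1 := fderiv_det_of_eq (A := formMatrix ε) (z := z) (h := sprayCoord ε z)
    (P := A.transpose) (Q := A) (c := 0)
    (fun i j ↦ (fderiv_dForm_apply hθ _ _ 0).1) (by
      ext i j
      have h := fderiv_dForm_apply_of_hamiltonian hθ (hε.of_le ENat.LEInfty.out) hS hham
        (phaseBasis n i) (phaseBasis n j)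
      rw [hrep, hrep] at h
      refine h.trans ?_
      simp [Matrix.mul_apply, formMatrix, mul_comm])
  have h2 : (fun w ↦ (formMatrix ε w).det * c) =ᶠ[𝓝 z] fun w ↦ (gram ε w).det ^ 2 :=
    hε2.mono fun w hw ↦ hc' ε w hw
  obtain ⟨D, hD, -⟩ := hasFDerivAt_det (A := formMatrix ε) (z := z) fun i j ↦
    (fderiv_dForm_apply hθ (phaseBasis n i) (phaseBasis n j) 0).1.hasFDerivAt
  have h3 := DFunLike.congr_fun ((hD.mul_const c).unique
    ((hδ.hasFDerivAt.pow 2).congr_of_eventuallyEq h2)) (sprayCoord ε z)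
  rw [hD.fderiv] at h1
  have h4 := hc' ε z hε2.self_of_nhds
  have h5 : traceL (Phase n) (fderiv ℝ (sprayCoord ε) z) = A.trace := by
    rw [traceL_apply, hA, LinearMap.trace_eq_matrix_trace ℝ (phaseBasis n)]
  simp at h3
  rw [h1, Matrix.trace_transpose] at h3
  rw [densityDiv, h5]
  -- The derivative is known for `(det g)²`, a constant multiple of `det W`; dividing by `2 det g`
  -- gives the one of `det g`.
  refine mul_left_cancel₀ hdet (mul_left_cancel₀ (two_ne_zero (α := ℝ)) ?_)
  linear_combination -h3 - 2 * A.trace * h4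

end Phase

/-! ### Liouville field, complete lifts and the two vanishing arguments in coordinates. -/

section PhaseFields

variable {n : ℕ}

/-- The coordinate form of the Liouville vector field. -/
noncomputable def liouvilleCoord (n : ℕ) : Phase n →L[ℝ] Phase n :=
  (ContinuousLinearMap.inr ℝ (EuclideanSpace ℝ (Fin n)) (EuclideanSpace ℝ (Fin n))).comp
    (ContinuousLinearMap.snd ℝ (EuclideanSpace ℝ (Fin n)) (EuclideanSpace ℝ (Fin n)))

theorem liouvilleCoord_apply (z : Phase n) : liouvilleCoord n z = (0, z.2) := rfl

theorem traceL_liouvilleCoord : traceL (Phase n) (liouvilleCoord n) = n := by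
  have h : (liouvilleCoord n : Phase n →ₗ[ℝ] Phase n) = LinearMap.prodMap 0 LinearMap.id :=
    LinearMap.ext fun _ ↦ rfl
  rw [traceL_apply, h, LinearMap.trace_prodMap']
  simp

/-- The coordinate form of the complete lift. -/
noncomputable def liftCoord (X : EuclideanSpace ℝ (Fin n) → EuclideanSpace ℝ (Fin n))
    (z : Phase n) : Phase n :=
  (X z.1, fderiv ℝ X z.1 z.2)

variable {X : EuclideanSpace ℝ (Fin n) → EuclideanSpace ℝ (Fin n)} {z : Phase n}

theorem contDiffAt_liftCoord (hX : ContDiffAt ℝ ∞ X z.1) : ContDiffAt ℝ ∞ (liftCoord X) z :=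
  (hX.comp z contDiffAt_fst).prodMk
    (((hX.fderiv_right (m := ∞) (by simp)).comp z contDiffAt_fst).clm_apply contDiffAt_snd)

theorem fderiv_liftCoord (hX : ContDiffAt ℝ ∞ X z.1) (h : Phase n) :
    fderiv ℝ (liftCoord X) z h =
      (fderiv ℝ X z.1 h.1, fderiv ℝ (fderiv ℝ X) z.1 h.1 z.2 + fderiv ℝ X z.1 h.2) := by
  have h1 := (hX.differentiableAt (by simp)).hasFDerivAt.comp z hasFDerivAt_fst
  have h2 := ((differentiableAt_fderiv (hX.of_le ENat.LEInfty.out)).hasFDerivAt.comp z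
    hasFDerivAt_fst).clm_apply (hasFDerivAt_snd (𝕜 := ℝ) (p := z))
  have h3 : HasFDerivAt (liftCoord X) _ z := h1.prodMk h2
  rw [h3.fderiv]
  simp [add_comm]

/-- The Jacobian of the lift is block triangular with the Jacobian of `X` twice on the diagonal; the
block `B` of second derivatives maps positions to velocities and has no trace. -/
theorem traceL_fderiv_liftCoord (hX : ContDiffAt ℝ ∞ X z.1) :
    traceL (Phase n) (fderiv ℝ (liftCoord X) z) = 2 * traceL _ (fderiv ℝ X z.1) := by
  set A : EuclideanSpace ℝ (Fin n) →ₗ[ℝ] EuclideanSpace ℝ (Fin n) :=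
    (fderiv ℝ X z.1).toLinearMap with hA
  set B : EuclideanSpace ℝ (Fin n) →ₗ[ℝ] EuclideanSpace ℝ (Fin n) :=
    ((fderiv ℝ (fderiv ℝ X) z.1).flip z.2).toLinearMap with hB
  have h : (fderiv ℝ (liftCoord X) z : Phase n →ₗ[ℝ] Phase n) = LinearMap.prodMap A A +
      (LinearMap.inr ℝ _ _ ∘ₗ B) ∘ₗ LinearMap.fst ℝ _ _ := by
    ext1
    · ext1 a
      simpa [hA, hB] using fderiv_liftCoord hX (a, 0)
    · ext1 a
      simpa [hA, hB] using fderiv_liftCoord hX (0, a)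
  rw [traceL_apply, h, map_add, LinearMap.trace_prodMap', LinearMap.trace_comp_comm',
    ← LinearMap.comp_assoc, LinearMap.fst_comp_inr, LinearMap.zero_comp, map_zero, traceL_apply]
  ring

/-- If a multiple `φ C` of the Liouville field preserves a density that is constant along the
rays, then `φ` is homogeneous of degree `-n`. -/
theorem fderiv_liouville_of_densityDiv {δ φ : Phase n → ℝ} (hφ : DifferentiableAt ℝ φ z)
    (hδ : fderiv ℝ δ z (0, z.2) = 0) (hδ0 : δ z ≠ 0)
    (h : densityDiv δ (fun w ↦ φ w • liouvilleCoord n w) z = 0) :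
    fderiv ℝ φ z (0, z.2) = -n * φ z := by
  have h1 : HasFDerivAt (fun w ↦ φ w • liouvilleCoord n w) _ z :=
    hφ.hasFDerivAt.smul (liouvilleCoord n).hasFDerivAt
  have h2 : traceL (Phase n) ((fderiv ℝ φ z).smulRight (liouvilleCoord n z)) =
      fderiv ℝ φ z (0, z.2) := by
    rw [traceL_apply]
    exact LinearMap.trace_smulRight (fderiv ℝ φ z : Phase n →ₗ[ℝ] ℝ) _
  rw [densityDiv, h1.fderiv, map_add, map_smul, map_smul, h2, traceL_liouvilleCoord,
    liouvilleCoord_apply, hδ] at h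
  simp only [smul_eq_mul, mul_zero, zero_add] at h
  have h3 := (mul_eq_zero.1 h).resolve_left hδ0
  linarith

/-- The Euler equation makes `t ^ k * f t` constant for `t > 0`, with value `f 1`. It tends to 0 as
`t` does, because `f` is continuous at 0 and `k` is positive. -/
theorem eq_zero_of_homogeneous_neg {f f' : ℝ → ℝ} {k : ℕ} (hk : k ≠ 0) (hc : ContinuousAt f 0)
    (hf : ∀ t, 0 < t → HasDerivAt f (f' t) t) (hf' : ∀ t, 0 < t → t * f' t = -k * f t) :
    f 1 = 0 := by
  obtain ⟨m, rfl⟩ := Nat.exists_eq_succ_of_ne_zero hk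
  have hd : ∀ t ∈ Ioi (0 : ℝ), HasDerivAt (fun t ↦ t ^ (m + 1) * f t) 0 t := by
    intro t ht
    have h := (hasDerivAt_pow (m + 1) t).mul (hf t ht)
    convert! h using 1
    have := hf' t ht
    rw [Nat.add_sub_cancel, pow_succ, mul_assoc (t ^ m), this]
    push_cast
    ring
  have hconst : ∀ t ∈ Ioi (0 : ℝ), t ^ (m + 1) * f t = f 1 := by
    intro t ht
    have := isOpen_Ioi.is_const_of_deriv_eq_zero isPreconnected_Ioi
      (fun x hx ↦ (hd x hx).differentiableAt.differentiableWithinAt)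
      (fun x hx ↦ (hd x hx).deriv) ht (by simp : (1 : ℝ) ∈ Ioi (0 : ℝ))
    simpa using this
  have hlim : Filter.Tendsto (fun t ↦ t ^ (m + 1) * f t) (𝓝[>] 0) (𝓝 0) := by
    have h : ContinuousAt (fun t ↦ t ^ (m + 1) * f t) 0 := (continuousAt_id.pow _).mul hc
    have h0 := h.tendsto
    simp only [zero_pow (Nat.succ_ne_zero m), zero_mul] at h0
    exact h0.mono_left nhdsWithin_le_nhds
  refine tendsto_nhds_unique (tendsto_const_nhds.congr' ?_) hlim
  filter_upwards [self_mem_nhdsWithin] with t ht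
  exact (hconst t ht).symm

variable {ε : Phase n → ℝ}

/-- The divergence of a conformal lift determines the conformal factor. -/
theorem conformalFactor_eq_zero (hn : n ≠ 0) (hε : ContDiffAt ℝ ∞ ε z)
    (hdet : (gram ε z).det ≠ 0) (hX : ContDiffAt ℝ ∞ X z.1) {c : ℝ}
    (hvol : densityDiv (fun w ↦ (gram ε w).det) (liftCoord X) z = 0)
    (hconf : ∀ a b : EuclideanSpace ℝ (Fin n),
      fderiv ℝ (fun w ↦ fderiv ℝ (fderiv ℝ ε) w (0, a) (0, b)) z (liftCoord X z) +
        fderiv ℝ (fderiv ℝ ε) z (0, fderiv ℝ X z.1 a) (0, b) +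
        fderiv ℝ (fderiv ℝ ε) z (0, a) (0, fderiv ℝ X z.1 b) =
      c * fderiv ℝ (fderiv ℝ ε) z (0, a) (0, b)) : c = 0 := by
  set b := EuclideanSpace.basisFun (Fin n) ℝ with hb
  set A := LinearMap.toMatrix b.toBasis b.toBasis
    (fderiv ℝ X z.1 : EuclideanSpace ℝ (Fin n) →ₗ[ℝ] EuclideanSpace ℝ (Fin n)) with hA
  have hAi : ∀ i k, (fderiv ℝ X z.1 (b i)) k = A k i := fun i k ↦ by
    rw [hA, LinearMap.toMatrix_apply]
    simp
    rfl
  have h1 := fderiv_det_of_eq (A := gram ε) (z := z) (h := liftCoord X z)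
    (P := A.transpose) (Q := A) (c := c)
    (fun i j ↦ (contDiffAt_gram_apply hε i j).differentiableAt (by simp)) (by
      ext i j
      have h := hconf (b i) (b j)
      have e1 : fderiv ℝ (fderiv ℝ ε) z (0, fderiv ℝ X z.1 (b i)) (0, b j) =
          ∑ k, gram ε z k j * A k i := by
        have := apply_vert_eq_sum ((fderiv ℝ (fderiv ℝ ε) z).flip (0, b j)) (fderiv ℝ X z.1 (b i))
        simp only [hAi] at this
        exact this
      have e2 : fderiv ℝ (fderiv ℝ ε) z (0, b i) (0, fderiv ℝ X z.1 (b j)) =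
          ∑ k, gram ε z i k * A k j := by
        have := apply_vert_eq_sum (fderiv ℝ (fderiv ℝ ε) z (0, b i)) (fderiv ℝ X z.1 (b j))
        simp only [hAi] at this
        exact this
      rw [e1, e2] at h
      have e3 := eq_sub_of_add_eq (eq_sub_of_add_eq h)
      refine e3.trans ?_
      simp only [Matrix.sub_apply, Matrix.smul_apply, Matrix.mul_apply, Matrix.transpose_apply,
        smul_eq_mul, mul_comm (A _ i)]
      rw [sub_right_comm]
      rfl)
  have h2 : traceL _ (fderiv ℝ X z.1) = A.trace := by
    rw [traceL_apply, hA, LinearMap.trace_eq_matrix_trace ℝ b.toBasis]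
  rw [densityDiv, h1, traceL_fderiv_liftCoord hX, h2, Matrix.trace_transpose] at hvol
  -- Jacobi's formula contributes `-2 tr A`, cancelling the trace `2 tr A` of the Jacobian of the
  -- lift.
  have h3 : (n * c) * (gram ε z).det = 0 := by
    rw [Fintype.card_fin] at hvol
    linear_combination hvol
  exact (mul_eq_zero.1 ((mul_eq_zero.1 h3).resolve_right hdet)).resolve_left (by exact_mod_cast hn)

end PhaseFields

/-! ### Induced charts of the tangent bundle and lifts read in them. -/

section TangentCharts

variable {n : ℕ} {M : Type*} [TopologicalSpace M] [ChartedSpace (EuclideanSpace ℝ (Fin n)) M]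
  [IsManifold (𝓡 n) ∞ M] {v₀ u : TangentBundle (𝓡 n) M}

theorem mem_extChartAt_tangent_source :
    u ∈ (extChartAt (𝓡 n).tangent v₀).source ↔ u.proj ∈ (extChartAt (𝓡 n) v₀.proj).source := by
  rw [extChartAt_source, extChartAt_source, TangentBundle.mem_chart_source_iff]

/-- The preferred chart of `TM` depends only on the base point of `v₀` and consists of the base
chart together with its derivative, so it gives the classical induced coordinates. -/
theorem extChartAt_tangent_apply (hu : u ∈ (extChartAt (𝓡 n).tangent v₀).source) :
    extChartAt (𝓡 n).tangent v₀ u =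
      (extChartAt (𝓡 n) v₀.proj u.proj, chartDeriv (𝓡 n) v₀.proj u.proj u.snd) := by
  have hu' : u.proj ∈ (chartAt (EuclideanSpace ℝ (Fin n)) v₀.proj).source := by
    simpa [mem_extChartAt_tangent_source] using hu
  rw [FiberBundle.extChartAt]
  have h1 := TangentBundle.continuousLinearMapAt_trivializationAt (I := 𝓡 n) hu'
  have h2 := (trivializationAt (EuclideanSpace ℝ (Fin n)) (TangentSpace (𝓡 n))
    v₀.proj).coe_linearMapAt_of_mem (R := ℝ) (b := u.proj) hu'
  rw [chartDeriv, ← h1]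
  exact Prod.ext rfl (congrFun h2 u.snd).symm

theorem extChartAt_tangent_target :
    (extChartAt (𝓡 n).tangent v₀).target = (extChartAt (𝓡 n) v₀.proj).target ×ˢ univ := by
  rw [FiberBundle.extChartAt_target]
  congr 1
  refine inter_eq_left.2 fun x hx ↦ ?_
  have := (extChartAt (𝓡 n) v₀.proj).map_target hx
  rwa [extChartAt_source] at this

theorem extChartAt_tangent_symm_proj
    {z : EuclideanSpace ℝ (Fin n) × EuclideanSpace ℝ (Fin n)}
    (hz : z ∈ (extChartAt (𝓡 n).tangent v₀).target) :
    ((extChartAt (𝓡 n).tangent v₀).symm z).proj = (extChartAt (𝓡 n) v₀.proj).symm z.1 := by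
  have hu := (extChartAt (𝓡 n).tangent v₀).map_target hz
  have h := extChartAt_tangent_apply hu
  rw [(extChartAt (𝓡 n).tangent v₀).right_inv hz] at h
  rw [congrArg Prod.fst h, (extChartAt (𝓡 n) v₀.proj).left_inv
    (mem_extChartAt_tangent_source.1 hu)]

theorem chartDeriv_extChartAt_tangent_symm
    {z : EuclideanSpace ℝ (Fin n) × EuclideanSpace ℝ (Fin n)}
    (hz : z ∈ (extChartAt (𝓡 n).tangent v₀).target) :
    chartDeriv (𝓡 n) v₀.proj _ ((extChartAt (𝓡 n).tangent v₀).symm z).snd = z.2 := by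
  have h := extChartAt_tangent_apply ((extChartAt (𝓡 n).tangent v₀).map_target hz)
  rw [(extChartAt (𝓡 n).tangent v₀).right_inv hz] at h
  exact (congrArg Prod.snd h).symm

theorem mdifferentiableAt_proj :
    MDifferentiableAt (𝓡 n).tangent (𝓡 n) (fun w : TangentBundle (𝓡 n) M ↦ w.proj) u :=
  (contMDiff_proj (n := ∞) (TangentSpace (𝓡 n))).mdifferentiableAt (by simp)

/-- The derivative of the projection `τ` is the first component in an induced chart. -/
theorem chartDeriv_jmap (hu : u ∈ (extChartAt (𝓡 n).tangent v₀).source)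
    (s : TangentSpace (𝓡 n).tangent u) :
    chartDeriv (𝓡 n) v₀.proj u.proj (jmap u s) = (chartDeriv (𝓡 n).tangent v₀ u s).1 := by
  have h1 := chartDeriv_mfderiv (f := fun w : TangentBundle (𝓡 n) M ↦ w.proj)
    (mem_extChartAt_tangent_source.1 hu) mdifferentiableAt_proj s
  have h2 := (ContinuousLinearMap.fst ℝ (EuclideanSpace ℝ (Fin n))
    (EuclideanSpace ℝ (Fin n))).hasMFDerivAt.comp u (hasMFDerivAt_extChartAt_chartDeriv hu)
  have h3 : extChartAt (𝓡 n) v₀.proj ∘ (fun w : TangentBundle (𝓡 n) M ↦ w.proj) =ᶠ[𝓝 u]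
      (ContinuousLinearMap.fst ℝ (EuclideanSpace ℝ (Fin n)) (EuclideanSpace ℝ (Fin n))) ∘
        extChartAt (𝓡 n).tangent v₀ := by
    filter_upwards [(isOpen_extChartAt_source (I := (𝓡 n).tangent) v₀).mem_nhds hu] with w hw
    rw [Function.comp_apply, Function.comp_apply, extChartAt_tangent_apply hw]
    rfl
  exact h1.trans (DFunLike.congr_fun (h3.mfderiv_eq.trans h2.mfderiv) s)

theorem extChartAt_tangent_mk {p : M} (hp : p ∈ (extChartAt (𝓡 n) v₀.proj).source)
    (w : TangentSpace (𝓡 n) p) :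
    extChartAt (𝓡 n).tangent v₀ ⟨p, w⟩ =
      (extChartAt (𝓡 n) v₀.proj p, chartDeriv (𝓡 n) v₀.proj p w) :=
  extChartAt_tangent_apply (mem_extChartAt_tangent_source.2 hp)

theorem contMDiff_fiber_inclusion (p : M) :
    ContMDiff 𝓘(ℝ, EuclideanSpace ℝ (Fin n)) (𝓡 n).tangent ∞
      (fun w : EuclideanSpace ℝ (Fin n) ↦ (⟨p, w⟩ : TangentBundle (𝓡 n) M)) := by
  intro w
  refine (contMDiffAt_totalSpace (F := EuclideanSpace ℝ (Fin n)) (E := TangentSpace (𝓡 n))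
    (f := fun w : EuclideanSpace ℝ (Fin n) ↦ (⟨p, w⟩ : TangentBundle (𝓡 n) M))).2
    ⟨contMDiffAt_const, ?_⟩
  have h2 := (trivializationAt (EuclideanSpace ℝ (Fin n)) (TangentSpace (𝓡 n))
    p).coe_linearMapAt_of_mem (R := ℝ) (b := p) (mem_chart_source _ p)
  have h3 := (((trivializationAt (EuclideanSpace ℝ (Fin n)) (TangentSpace (𝓡 n))
    p).continuousLinearMapAt ℝ p : EuclideanSpace ℝ (Fin n) →L[ℝ] EuclideanSpace ℝ (Fin n)).contDiff
      (n := ∞)).contMDiff w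
  exact h3.congr_of_eventuallyEq (Filter.Eventually.of_forall fun a ↦ (congrFun h2 a).symm)

/-- The vertical lift in an induced chart. -/
theorem chartDeriv_vlift (hu : u ∈ (extChartAt (𝓡 n).tangent v₀).source)
    (a : TangentSpace (𝓡 n) u.proj) :
    chartDeriv (𝓡 n).tangent v₀ u (vlift u a) = (0, chartDeriv (𝓡 n) v₀.proj u.proj a) := by
  have h1 := chartDeriv_mfderiv (x₀ := v₀)
    (f := fun w : EuclideanSpace ℝ (Fin n) ↦ (⟨u.proj, w⟩ : TangentBundle (𝓡 n) M)) (x := u.snd)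
    hu ((contMDiff_fiber_inclusion u.proj).mdifferentiableAt (by simp)) a
  have h2 : extChartAt (𝓡 n).tangent v₀ ∘
      (fun w : EuclideanSpace ℝ (Fin n) ↦ (⟨u.proj, w⟩ : TangentBundle (𝓡 n) M)) =
      fun w ↦ (extChartAt (𝓡 n) v₀.proj u.proj,
        (chartDeriv (𝓡 n) v₀.proj u.proj : EuclideanSpace ℝ (Fin n) →L[ℝ] _) w) :=
    funext fun w ↦ extChartAt_tangent_mk (mem_extChartAt_tangent_source.1 hu) w
  have h0 : HasFDerivAt (𝕜 := ℝ) (fun w : EuclideanSpace ℝ (Fin n) ↦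
      (extChartAt (𝓡 n) v₀.proj u.proj,
        (chartDeriv (𝓡 n) v₀.proj u.proj : EuclideanSpace ℝ (Fin n) →L[ℝ] _) w)) _ u.snd :=
    (hasFDerivAt_const (𝕜 := ℝ) (extChartAt (𝓡 n) v₀.proj u.proj)
      (u.snd : EuclideanSpace ℝ (Fin n))).prodMk
      ((chartDeriv (𝓡 n) v₀.proj u.proj :
        EuclideanSpace ℝ (Fin n) →L[ℝ] EuclideanSpace ℝ (Fin n)).hasFDerivAt)
  have h3 := h0.hasMFDerivAt
  rw [h2] at h1
  exact h1.trans (DFunLike.congr_fun h3.mfderiv a)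

theorem chartDeriv_liouville (hu : u ∈ (extChartAt (𝓡 n).tangent v₀).source) :
    chartDeriv (𝓡 n).tangent v₀ u (liouville u) = (0, (extChartAt (𝓡 n).tangent v₀ u).2) := by
  rw [liouville, chartDeriv_vlift hu, extChartAt_tangent_apply hu]

/-- The components of a vector field on `M` in the preferred chart at `p₀`. -/
noncomputable def coordField (p₀ : M) (X : (p : M) → TangentSpace (𝓡 n) p)
    (x : EuclideanSpace ℝ (Fin n)) : EuclideanSpace ℝ (Fin n) :=
  chartDeriv (𝓡 n) p₀ ((extChartAt (𝓡 n) p₀).symm x) (X ((extChartAt (𝓡 n) p₀).symm x))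

theorem contDiffOn_coordField (p₀ : M) {X : (p : M) → TangentSpace (𝓡 n) p}
    (hX : ContMDiff (𝓡 n) (𝓡 n).tangent ∞ (fun p ↦ (⟨p, X p⟩ : TangentBundle (𝓡 n) M))) :
    ContDiffOn ℝ ∞ (coordField p₀ X) (extChartAt (𝓡 n) p₀).target := by
  rw [← contMDiffOn_iff_contDiffOn]
  have h1 := hX.comp_contMDiffOn (contMDiffOn_extChartAt_symm (I := 𝓡 n) (n := ∞) p₀)
  -- Any vector over `p₀` selects the same induced chart; the zero vector is a convenient choice.
  have h2 := (contMDiffOn_extChartAt (I := (𝓡 n).tangent) (n := ∞)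
    (x := (⟨p₀, 0⟩ : TangentBundle (𝓡 n) M))).comp h1 (fun x hx ↦ by
      have := (extChartAt (𝓡 n) p₀).map_target hx
      simpa using this)
  have h3 := (contDiff_snd (𝕜 := ℝ) (n := ∞) (E := EuclideanSpace ℝ (Fin n))
    (F := EuclideanSpace ℝ (Fin n))).contMDiff.comp_contMDiffOn h2
  refine h3.congr fun x hx ↦ ?_
  exact (congrArg Prod.snd (extChartAt_tangent_mk (v₀ := (⟨p₀, 0⟩ : TangentBundle (𝓡 n) M))
    ((extChartAt (𝓡 n) p₀).map_target hx) (X _))).symm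

/-- Coordinate independence of the complete lift. Differentiating the transformation law `X₂ ∘ ψ =
Dψ X₁` along `y` produces the same terms as applying the derivative of the induced transition map,
once the arguments of the second derivative of `ψ` are exchanged. -/
theorem fderiv_induced_transition {E : Type*} [NormedAddCommGroup E] [NormedSpace ℝ E]
    {ψ X₁ X₂ : E → E} {Ψ : E × E → E × E} {x y : E}
    (hψ : ContDiffAt ℝ ∞ ψ x) (hΨ : ∀ᶠ z in 𝓝 (x, y), Ψ z = (ψ z.1, fderiv ℝ ψ z.1 z.2))
    (hX₁ : DifferentiableAt ℝ X₁ x) (hX₂ : DifferentiableAt ℝ X₂ (ψ x))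
    (h : ∀ᶠ q in 𝓝 x, X₂ (ψ q) = fderiv ℝ ψ q (X₁ q)) :
    fderiv ℝ Ψ (x, y) (X₁ x, fderiv ℝ X₁ x y) =
      (X₂ (ψ x), fderiv ℝ X₂ (ψ x) (fderiv ℝ ψ x y)) := by
  have hψd : DifferentiableAt ℝ ψ x := hψ.differentiableAt (by simp)
  have hψ' : DifferentiableAt ℝ (fderiv ℝ ψ) x :=
    (hψ.fderiv_right (m := 1)
      (by rw [one_add_one_eq_two]; exact ENat.LEInfty.out)).differentiableAt one_ne_zero
  have hsymm : IsSymmSndFDerivAt ℝ ψ x := hψ.isSymmSndFDerivAt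
    (by simpa using (ENat.LEInfty.out : (2 : ℕ∞ω) ≤ ∞))
  have hd : HasFDerivAt (fun z : E × E ↦ (ψ z.1, fderiv ℝ ψ z.1 z.2)) _ (x, y) :=
    (hψd.hasFDerivAt.comp (x, y) hasFDerivAt_fst).prodMk
      ((hψ'.hasFDerivAt.comp (x, y) hasFDerivAt_fst).clm_apply hasFDerivAt_snd)
  have h1 : HasFDerivAt (fun q ↦ X₂ (ψ q)) _ x := hX₂.hasFDerivAt.comp x hψd.hasFDerivAt
  have h2 := (hψ'.hasFDerivAt.clm_apply hX₁.hasFDerivAt).congr_of_eventuallyEq h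
  have h3 := DFunLike.congr_fun (h1.unique h2) y
  rw [Filter.EventuallyEq.fderiv_eq hΨ, hd.fderiv, h.self_of_nhds]
  simp only [ContinuousLinearMap.comp_apply, add_apply,
    ContinuousLinearMap.flip_apply] at h3
  simp only [ContinuousLinearMap.prod_apply, ContinuousLinearMap.comp_apply,
    add_apply, ContinuousLinearMap.flip_apply, ContinuousLinearMap.coe_fst',
    ContinuousLinearMap.coe_snd', h3, hsymm.eq (X₁ x) y]

theorem mfderiv_section_snd {X : (p : M) → TangentSpace (𝓡 n) p}
    (hX : ContMDiff (𝓡 n) (𝓡 n).tangent ∞ (fun p ↦ (⟨p, X p⟩ : TangentBundle (𝓡 n) M)))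
    (p : M) (w : TangentSpace (𝓡 n) p) :
    (mfderiv (𝓡 n) (𝓡 n).tangent (fun p ↦ (⟨p, X p⟩ : TangentBundle (𝓡 n) M)) p w :
      EuclideanSpace ℝ (Fin n) × EuclideanSpace ℝ (Fin n)).2 =
    fderiv ℝ (coordField p X) (extChartAt (𝓡 n) p p) w := by
  set sec : M → TangentBundle (𝓡 n) M := fun p ↦ ⟨p, X p⟩ with hsec
  have h1 := chartDeriv_mfderiv (x₀ := sec p) (f := sec) (mem_extChartAt_source _)
    (hX.mdifferentiableAt (by simp)) w
  rw [chartDeriv_self] at h1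
  have hd : DifferentiableAt ℝ (coordField p X) (extChartAt (𝓡 n) p p) :=
    ((contDiffOn_coordField p hX).contDiffAt ((isOpen_extChartAt_target p).mem_nhds
      (mem_extChartAt_target p))).differentiableAt (by simp)
  have h0 : HasFDerivAt (fun q ↦ (q, coordField p X q)) _ (extChartAt (𝓡 n) p p) :=
    (hasFDerivAt_id (𝕜 := ℝ) _).prodMk hd.hasFDerivAt
  have h2 := h0.hasMFDerivAt.comp p (hasMFDerivAt_extChartAt_chartDeriv (mem_extChartAt_source p))
  have h3 : extChartAt (𝓡 n).tangent (sec p) ∘ sec =ᶠ[𝓝 p]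
      (fun q ↦ (q, coordField p X q)) ∘ extChartAt (𝓡 n) p := by
    filter_upwards [extChartAt_source_mem_nhds (I := 𝓡 n) p] with q hq
    rw [Function.comp_apply, hsec, extChartAt_tangent_mk (v₀ := ⟨p, X p⟩) hq, Function.comp_apply,
      coordField, (extChartAt (𝓡 n) p).left_inv hq]
  have h4 := h1.trans (DFunLike.congr_fun (h3.mfderiv_eq.trans h2.mfderiv) w)
  refine (congrArg Prod.snd h4).trans ?_
  change fderiv ℝ (coordField p X) (extChartAt (𝓡 n) p p) (chartDeriv (𝓡 n) p p w) = _
  rw [chartDeriv_self]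

/-- `completeLift` is defined at `u` through the chart at `u`. Brackets need its expression in one
chart on a whole neighbourhood, which the transformation law supplies. -/
theorem chartDeriv_completeLift {X : (p : M) → TangentSpace (𝓡 n) p}
    (hX : ContMDiff (𝓡 n) (𝓡 n).tangent ∞ (fun p ↦ (⟨p, X p⟩ : TangentBundle (𝓡 n) M)))
    (hu : u ∈ (extChartAt (𝓡 n).tangent v₀).source) :
    chartDeriv (𝓡 n).tangent v₀ u (completeLift X u) =
     (coordField v₀.proj X (extChartAt (𝓡 n).tangent v₀ u).1,
      fderiv ℝ (coordField v₀.proj X) (extChartAt (𝓡 n).tangent v₀ u).1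
        (extChartAt (𝓡 n).tangent v₀ u).2) := by
  have hp := mem_extChartAt_tangent_source.1 hu
  have hpu := mem_extChartAt_source (I := 𝓡 n) u.proj
  set φ := extChartAt (𝓡 n) u.proj with hφ
  set ψ := extChartAt (𝓡 n) v₀.proj ∘ φ.symm with hψ
  have hψx : ψ (φ u.proj) = extChartAt (𝓡 n) v₀.proj u.proj := by
    rw [hψ, Function.comp_apply, φ.left_inv hpu]
  have hψs : ContDiffAt ℝ ∞ ψ (φ u.proj) := by
    have := contDiffWithinAt_ext_coord_change (I := 𝓡 n) (n := ∞) v₀.proj u.proj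
      (y := φ u.proj) (by
        rw [PartialEquiv.trans_source]
        exact ⟨φ.map_source hpu, by rwa [mem_preimage, φ.left_inv hpu]⟩)
    rwa [(𝓡 n).range_eq_univ, contDiffWithinAt_univ] at this
  have heu : extChartAt (𝓡 n).tangent u u = (φ u.proj, u.snd) := by
    rw [extChartAt_tangent_apply (mem_extChartAt_source u), chartDeriv_self]
    rfl
  have hnear : ∀ᶠ x in 𝓝 (φ u.proj), x ∈ φ.target ∧
      φ.symm x ∈ (extChartAt (𝓡 n) v₀.proj).source := by
    refine Filter.Eventually.and ((isOpen_extChartAt_target u.proj).mem_nhds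
      (mem_extChartAt_target u.proj)) ((continuousAt_extChartAt_symm u.proj).eventually ?_)
    rw [extChartAt_to_inv]
    exact (isOpen_extChartAt_source v₀.proj).mem_nhds hp
  have hΨ : ∀ᶠ z in 𝓝 (φ u.proj, (u.snd : EuclideanSpace ℝ (Fin n))),
      (extChartAt (𝓡 n).tangent v₀ ∘ (extChartAt (𝓡 n).tangent u).symm) z =
        (ψ z.1, fderiv ℝ ψ z.1 z.2) := by
    filter_upwards [continuousAt_fst.eventually hnear] with z hz
    have hzt : z ∈ (extChartAt (𝓡 n).tangent u).target := by
      rw [extChartAt_tangent_target]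
      exact ⟨hz.1, mem_univ _⟩
    have hproj := extChartAt_tangent_symm_proj hzt
    have hzs : ((extChartAt (𝓡 n).tangent u).symm z).proj ∈ (extChartAt (𝓡 n) v₀.proj).source := by
      rw [hproj]
      exact hz.2
    have hzs' : ((extChartAt (𝓡 n).tangent u).symm z).proj ∈ (extChartAt (𝓡 n) u.proj).source := by
      rw [hproj]
      exact φ.map_target hz.1
    rw [Function.comp_apply, extChartAt_tangent_apply (mem_extChartAt_tangent_source.2 hzs),
      ← fderiv_chart_transition hzs hzs', chartDeriv_extChartAt_tangent_symm hzt, hproj,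
      ← hφ, φ.right_inv hz.1]
    rfl
  have hX₁ : DifferentiableAt ℝ (coordField u.proj X) (φ u.proj) :=
    ((contDiffOn_coordField u.proj hX).contDiffAt ((isOpen_extChartAt_target _).mem_nhds
      (mem_extChartAt_target _))).differentiableAt (by simp)
  have hX₂ : DifferentiableAt ℝ (coordField v₀.proj X) (ψ (φ u.proj)) := by
    rw [hψx]
    exact ((contDiffOn_coordField v₀.proj hX).contDiffAt ((isOpen_extChartAt_target _).mem_nhds
      ((extChartAt (𝓡 n) v₀.proj).map_source hp))).differentiableAt (by simp)
  have hrel : ∀ᶠ q in 𝓝 (φ u.proj),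
      coordField v₀.proj X (ψ q) = fderiv ℝ ψ q (coordField u.proj X q) := by
    filter_upwards [hnear] with q hq
    have h := fderiv_chart_transition (J := 𝓡 n) hq.2 (φ.map_target hq.1) (X (φ.symm q))
    rw [← hφ, φ.right_inv hq.1] at h
    rw [coordField, coordField, hψ, Function.comp_apply,
      (extChartAt (𝓡 n) v₀.proj).left_inv hq.2]
    exact h.symm
  have key := fderiv_induced_transition hψs hΨ hX₁ hX₂ hrel
  have htr := fderiv_chart_transition hu (mem_extChartAt_source u) (completeLift X u)
  rw [chartDeriv_self, heu] at htr
  have hcl : completeLift X u = ((coordField u.proj X (φ u.proj),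
      fderiv ℝ (coordField u.proj X) (φ u.proj) u.snd) :
        EuclideanSpace ℝ (Fin n) × EuclideanSpace ℝ (Fin n)) := by
    refine Prod.ext ?_ (mfderiv_section_snd hX u.proj u.snd)
    rw [coordField, φ.left_inv hpu, chartDeriv_self]
    rfl
  rw [extChartAt_tangent_apply hu, ← htr, ← hψx]
  refine (congrArg _ hcl).trans (key.trans ?_)
  congr 2
  have h := fderiv_chart_transition hp hpu u.snd
  rwa [chartDeriv_self] at h

end TangentCharts

/-! ### Metric, fundamental form and Dazord form in induced charts. -/

section FinslerCharts

variable {n : ℕ} {M : Type*} [TopologicalSpace M] [ChartedSpace (EuclideanSpace ℝ (Fin n)) M]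
  [IsManifold (𝓡 n) ∞ M] {v₀ u : TangentBundle (𝓡 n) M} {F : TangentBundle (𝓡 n) M → ℝ}

theorem snd_extChartAt_tangent_ne_zero (hu : u ∈ (extChartAt (𝓡 n).tangent v₀).source) :
    (extChartAt (𝓡 n).tangent v₀ u).2 ≠ 0 ↔ u ∈ deleted n M := by
  rw [extChartAt_tangent_apply hu]
  refine not_congr ⟨fun h ↦ ?_, fun h ↦ ?_⟩
  · exact chartDeriv_injective (mem_extChartAt_tangent_source.1 hu) (h.trans (map_zero _).symm)
  · exact (congrArg (chartDeriv (𝓡 n) v₀.proj u.proj) h).trans (map_zero _)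

theorem deleted_mem_nhds (hu0 : u ∈ deleted n M) : deleted n M ∈ 𝓝 u := by
  have h1 : ContinuousAt (fun w ↦ (extChartAt (𝓡 n).tangent u w).2) u :=
    continuous_snd.continuousAt.comp (continuousAt_extChartAt (I := (𝓡 n).tangent) u)
  filter_upwards [h1.eventually_ne ((snd_extChartAt_tangent_ne_zero
    (mem_extChartAt_source u)).2 hu0), extChartAt_source_mem_nhds (I := (𝓡 n).tangent) u]
    with w h2 h3
  exact (snd_extChartAt_tangent_ne_zero h3).1 h2

/-- The energy in the chart of `TM` induced by the preferred chart at `v₀.proj`. -/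
noncomputable def energyCoord (F : TangentBundle (𝓡 n) M → ℝ) (v₀ : TangentBundle (𝓡 n) M)
    (z : Phase n) : ℝ :=
  energy F ((extChartAt (𝓡 n).tangent v₀).symm z)

theorem contDiffAt_comp_extChartAt_symm {f : TangentBundle (𝓡 n) M → ℝ} {k : ℕ∞ω} (hk : k ≤ ∞)
    (hf : ContMDiffOn (𝓡 n).tangent 𝓘(ℝ, ℝ) k f (deleted n M))
    (hu : u ∈ (extChartAt (𝓡 n).tangent v₀).source) (hu0 : u ∈ deleted n M) :
    ContDiffAt ℝ k (fun z ↦ f ((extChartAt (𝓡 n).tangent v₀).symm z))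
      (extChartAt (𝓡 n).tangent v₀ u) := by
  have h1 : ContMDiffAt (𝓡 n).tangent 𝓘(ℝ, ℝ) k f
      ((extChartAt (𝓡 n).tangent v₀).symm (extChartAt (𝓡 n).tangent v₀ u)) := by
    rw [(extChartAt (𝓡 n).tangent v₀).left_inv hu]
    exact hf.contMDiffAt (deleted_mem_nhds hu0)
  have h2 : ContMDiffAt 𝓘(ℝ, Phase n) (𝓡 n).tangent k (extChartAt (𝓡 n).tangent v₀).symm
      (extChartAt (𝓡 n).tangent v₀ u) :=
    ((contMDiffOn_extChartAt_symm (I := (𝓡 n).tangent) (n := ∞) v₀).contMDiffAt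
      ((isOpen_extChartAt_target v₀).mem_nhds
        ((extChartAt (𝓡 n).tangent v₀).map_source hu))).of_le hk
  exact contMDiffAt_iff_contDiffAt.1 (h1.comp _ h2)

theorem eventuallyEq_comp_extChartAt {f : TangentBundle (𝓡 n) M → ℝ}
    (hu : u ∈ (extChartAt (𝓡 n).tangent v₀).source) :
    f =ᶠ[𝓝 u] (fun z ↦ f ((extChartAt (𝓡 n).tangent v₀).symm z)) ∘
      extChartAt (𝓡 n).tangent v₀ := by
  filter_upwards [(isOpen_extChartAt_source (I := (𝓡 n).tangent) v₀).mem_nhds hu] with w hw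
  rw [Function.comp_apply, (extChartAt (𝓡 n).tangent v₀).left_inv hw]

theorem contDiffAt_energyCoord (hF : IsFinsler F)
    (hu : u ∈ (extChartAt (𝓡 n).tangent v₀).source) (hu0 : u ∈ deleted n M) :
    ContDiffAt ℝ ∞ (energyCoord F v₀) (extChartAt (𝓡 n).tangent v₀ u) :=
  ((contDiffAt_comp_extChartAt_symm le_rfl hF.smooth hu hu0).pow 2).div_const 2

theorem energyCoord_extChartAt (hu : u ∈ (extChartAt (𝓡 n).tangent v₀).source) :
    energyCoord F v₀ (extChartAt (𝓡 n).tangent v₀ u) = energy F u := by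
  rw [energyCoord, (extChartAt (𝓡 n).tangent v₀).left_inv hu]

/-- Second-order chain rule for an affine inner map. It serves both the inclusion of a fibre, where
it computes `metric`, and the dilations of the fibres. -/
theorem fderiv_fderiv_comp_add {V W : Type*} [NormedAddCommGroup V] [NormedSpace ℝ V]
    [NormedAddCommGroup W] [NormedSpace ℝ W] {f : W → ℝ} (c : W) (L : V →L[ℝ] W) {x : V}
    (hf : ContDiffAt ℝ 2 f (c + L x)) (a b : V) :
    fderiv ℝ (fderiv ℝ (fun w ↦ f (c + L w))) x a b =
      fderiv ℝ (fderiv ℝ f) (c + L x) (L a) (L b) := by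
  have hL : ∀ w, HasFDerivAt (fun w ↦ c + L w) L w := fun w ↦ L.hasFDerivAt.const_add c
  have h1 : fderiv ℝ (fun w ↦ f (c + L w)) =ᶠ[𝓝 x] fun w ↦ (fderiv ℝ f (c + L w)).comp L := by
    have h2 : ∀ᶠ w in 𝓝 x, ContDiffAt ℝ 2 f (c + L w) :=
      (hL x).continuousAt.eventually (hf.eventually (by simp))
    filter_upwards [h2] with w hw
    exact ((hw.differentiableAt (by simp)).hasFDerivAt.comp w (hL w)).fderiv
  have h3 := ((differentiableAt_fderiv hf).hasFDerivAt.comp x (hL x)).clm_comp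
    (hasFDerivAt_const L x)
  rw [(h3.congr_of_eventuallyEq h1).fderiv]
  simp

/-- The metric tensor in an induced chart. -/
theorem metric_eq (hF : IsFinsler F) (hu : u ∈ (extChartAt (𝓡 n).tangent v₀).source)
    (hu0 : u ∈ deleted n M) (a b : TangentSpace (𝓡 n) u.proj) :
    metric F u a b = fderiv ℝ (fderiv ℝ (energyCoord F v₀)) (extChartAt (𝓡 n).tangent v₀ u)
      (0, chartDeriv (𝓡 n) v₀.proj u.proj a) (0, chartDeriv (𝓡 n) v₀.proj u.proj b) := by
  have hp := mem_extChartAt_tangent_source.1 hu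
  set c : Phase n := (extChartAt (𝓡 n) v₀.proj u.proj, 0) with hc
  set A : EuclideanSpace ℝ (Fin n) →L[ℝ] EuclideanSpace ℝ (Fin n) :=
    chartDeriv (𝓡 n) v₀.proj u.proj with hA
  set L := (ContinuousLinearMap.inr ℝ (EuclideanSpace ℝ (Fin n))
    (EuclideanSpace ℝ (Fin n))).comp A with hL
  have hcL : ∀ w : EuclideanSpace ℝ (Fin n),
      c + L w = extChartAt (𝓡 n).tangent v₀ (⟨u.proj, w⟩ : TangentBundle (𝓡 n) M) := by
    intro w
    refine Eq.trans ?_ (extChartAt_tangent_mk hp w).symm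
    exact Prod.ext (add_zero _) (zero_add _)
  have h1 : (fun w : EuclideanSpace ℝ (Fin n) ↦ energy F ⟨u.proj, w⟩) =
      fun w ↦ energyCoord F v₀ (c + L w) := funext fun w ↦ by
    rw [hcL]
    exact (energyCoord_extChartAt (u := (⟨u.proj, w⟩ : TangentBundle (𝓡 n) M))
      (mem_extChartAt_tangent_source.2 hp)).symm
  have hu' : c + L u.snd = extChartAt (𝓡 n).tangent v₀ u := hcL u.snd
  have h2 := fderiv_fderiv_comp_add (f := energyCoord F v₀) c L (x := u.snd) (by
    rw [hu']
    exact (contDiffAt_energyCoord hF hu hu0).of_le ENat.LEInfty.out) a b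
  rw [metric, h1]
  exact h2.trans (by rw [hu']; rfl)

theorem det_gram_energyCoord_ne_zero (hF : IsFinsler F)
    (hu : u ∈ (extChartAt (𝓡 n).tangent v₀).source) (hu0 : u ∈ deleted n M) :
    (gram (energyCoord F v₀) (extChartAt (𝓡 n).tangent v₀ u)).det ≠ 0 := by
  intro h0
  have hp := mem_extChartAt_tangent_source.1 hu
  obtain ⟨v, hv, hvg⟩ := Matrix.exists_vecMul_eq_zero_iff.2 h0
  obtain ⟨a, ha⟩ := chartDeriv_surjective hp (WithLp.toLp 2 v)
  refine hv ?_
  have ha0 : a = 0 := hF.nondegenerate u hu0 a fun b ↦ by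
    rw [metric_eq hF hu hu0, ha, apply_vert_eq_sum]
    refine Finset.sum_eq_zero fun j _ ↦ mul_eq_zero_of_left ?_ _
    have h1 := apply_vert_eq_sum ((fderiv ℝ (fderiv ℝ (energyCoord F v₀))
      (extChartAt (𝓡 n).tangent v₀ u)).flip (0, EuclideanSpace.basisFun (Fin n) ℝ j))
      (WithLp.toLp 2 v)
    refine h1.trans (Eq.trans ?_ (congrFun hvg j))
    exact Finset.sum_congr rfl fun i _ ↦ mul_comm _ _
  rw [ha0] at ha
  exact congrArg WithLp.ofLp ((map_zero _).symm.trans ha).symm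

theorem hilbertForm_eq (hF : IsFinsler F) (hu : u ∈ (extChartAt (𝓡 n).tangent v₀).source)
    (hu0 : u ∈ deleted n M) :
    hilbertForm F u = (ContinuousAlternatingMap.ofSubsingleton ℝ (Phase n) ℝ (0 : Fin 1)
      (hilbertCoord (energyCoord F v₀)
        (extChartAt (𝓡 n).tangent v₀ u))).compContinuousLinearMap
          (chartDeriv (𝓡 n).tangent v₀ u) := by
  ext s
  have h1 := dirDeriv_eq_of_chart hu (eventuallyEq_comp_extChartAt (f := energy F) hu)
    ((contDiffAt_energyCoord hF hu hu0).differentiableAt (by simp)) (vlift u (jmap u (s 0)))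
  rw [chartDeriv_vlift hu, chartDeriv_jmap hu] at h1
  exact h1

theorem fundForm_apply (hF : IsFinsler F) (hu : u ∈ (extChartAt (𝓡 n).tangent v₀).source)
    (hu0 : u ∈ deleted n M) (s : Fin 2 → TangentSpace (𝓡 n).tangent u) :
    fundForm F u s = dForm (hilbertCoord (energyCoord F v₀)) (extChartAt (𝓡 n).tangent v₀ u)
      (chartDeriv (𝓡 n).tangent v₀ u (s 0)) (chartDeriv (𝓡 n).tangent v₀ u (s 1)) := by
  have hθ : DifferentiableAt ℝ (hilbertCoord (energyCoord F v₀))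
      (extChartAt (𝓡 n).tangent v₀ u) :=
    (contDiffAt_hilbertCoord (m := 1) (contDiffAt_energyCoord hF hu hu0)
      (by rw [one_add_one_eq_two]; exact ENat.LEInfty.out)).differentiableAt one_ne_zero
  have hα := ((ContinuousAlternatingMap.ofSubsingletonLIE (𝕜 := ℝ) (E := Phase n)
    (F := ℝ) (0 : Fin 1)).toContinuousLinearEquiv.toContinuousLinearMap.hasFDerivAt.comp
      (extChartAt (𝓡 n).tangent v₀ u) hθ.hasFDerivAt)
  have h1 := mextDeriv_eq_of_chart (α := hilbertForm F)
    (α' := fun z ↦ ContinuousAlternatingMap.ofSubsingleton ℝ (Phase n) ℝ (0 : Fin 1)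
      (hilbertCoord (energyCoord F v₀) z)) hu (by
      filter_upwards [(isOpen_extChartAt_source (I := (𝓡 n).tangent) v₀).mem_nhds hu,
        deleted_mem_nhds hu0] with w h1 h2
      exact hilbertForm_eq hF h1 h2) hα.differentiableAt
  rw [fundForm, h1]
  refine (extDeriv_apply hα.differentiableAt _).trans ?_
  rw [Fin.sum_univ_two]
  have h2 : ∀ w : Phase n, HasFDerivAt (fun z ↦ hilbertCoord (energyCoord F v₀) z w)
      ((fderiv ℝ (hilbertCoord (energyCoord F v₀)) (extChartAt (𝓡 n).tangent v₀ u)).flip w)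
      (extChartAt (𝓡 n).tangent v₀ u) := fun w ↦ by
    simpa using! hθ.hasFDerivAt.clm_apply (hasFDerivAt_const w _)
  have h3 := fun w : Phase n ↦ (h2 w).fderiv
  rw [dForm_apply, sub_eq_add_neg]
  refine congrArg₂ _ ?_ ?_
  · rw [Fin.val_zero, pow_zero, one_smul]
    exact DFunLike.congr_fun (h3 _) _
  · rw [Fin.val_one, pow_one, neg_one_smul]
    exact congrArg _ (DFunLike.congr_fun (h3 _) _)

/-- The Dazord volume form in an induced chart. -/
theorem dazord_apply (hF : IsFinsler F) (hu : u ∈ (extChartAt (𝓡 n).tangent v₀).source)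
    (hu0 : u ∈ deleted n M) (s : Fin (2 * n) → TangentSpace (𝓡 n).tangent u) :
    dazord F u s = ((-1 : ℝ) ^ (n * (n - 1) / 2) / (n.factorial : ℝ)) *
      ((gram (energyCoord F v₀) (extChartAt (𝓡 n).tangent v₀ u)).det *
        wedgePow (stdForm n) n fun i ↦ chartDeriv (𝓡 n).tangent v₀ u (s i)) := by
  set z := extChartAt (𝓡 n).tangent v₀ u with hz
  have hε : ContDiffAt ℝ 2 (energyCoord F v₀) z :=
    (contDiffAt_energyCoord hF hu hu0).of_le ENat.LEInfty.out
  have h1 : (fundForm F u).toAlternatingMap = ((stdForm n).compLinearMap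
      (legendre (energyCoord F v₀) z)).compLinearMap
        (chartDeriv (𝓡 n).tangent v₀ u).toLinearMap := by
    ext s
    exact (fundForm_apply hF hu hu0 s).trans (dForm_eq_stdForm_legendre hε _ _)
  -- Any basis of `2 * n` vectors makes the form top dimensional; pullback by the Legendre
  -- derivative then multiplies it by `det g`.
  obtain ⟨b, -⟩ := exists_basis_wedgePow_stdForm_ne_zero n
  rw [dazord, h1, wedgePow_compLinearMap, wedgePow_compLinearMap,
    compLinearMap_eq_det_smul _ b, det_legendre]
  rfl

end FinslerCharts

/-! ### Volume preservation, the spray and the conformal case. -/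

section FinslerFields

variable {n : ℕ} {M : Type*} [TopologicalSpace M] [ChartedSpace (EuclideanSpace ℝ (Fin n)) M]
  [IsManifold (𝓡 n) ∞ M] {v₀ u : TangentBundle (𝓡 n) M} {F : TangentBundle (𝓡 n) M → ℝ}
  {X : (p : M) → TangentSpace (𝓡 n) p}

theorem eventually_mem_source_deleted (hu : u ∈ (extChartAt (𝓡 n).tangent v₀).source)
    (hu0 : u ∈ deleted n M) :
    ∀ᶠ w in 𝓝 u, w ∈ (extChartAt (𝓡 n).tangent v₀).source ∧ w ∈ deleted n M :=
  ((isOpen_extChartAt_source (I := (𝓡 n).tangent) v₀).eventually_mem hu).and (deleted_mem_nhds hu0)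

theorem eventually_extChartAt_of_eventually {P : Phase n → Prop}
    (hu : u ∈ (extChartAt (𝓡 n).tangent v₀).source)
    (h : ∀ᶠ w in 𝓝 u, P (extChartAt (𝓡 n).tangent v₀ w)) :
    ∀ᶠ z in 𝓝 (extChartAt (𝓡 n).tangent v₀ u), P z := by
  have h1 : ContinuousAt (extChartAt (𝓡 n).tangent v₀).symm (extChartAt (𝓡 n).tangent v₀ u) :=
    continuousAt_extChartAt_symm' hu
  have h2 := h1.eventually (p := fun w ↦ P (extChartAt (𝓡 n).tangent v₀ w)) (by
    rwa [(extChartAt (𝓡 n).tangent v₀).left_inv hu])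
  filter_upwards [h2, (isOpen_extChartAt_target (I := (𝓡 n).tangent) v₀).mem_nhds
    ((extChartAt (𝓡 n).tangent v₀).map_source hu)] with z hz hzt
  rwa [(extChartAt (𝓡 n).tangent v₀).right_inv hzt] at hz

theorem contDiffAt_coordField
    (hX : ContMDiff (𝓡 n) (𝓡 n).tangent ∞ (fun p ↦ (⟨p, X p⟩ : TangentBundle (𝓡 n) M)))
    (hu : u ∈ (extChartAt (𝓡 n).tangent v₀).source) :
    ContDiffAt ℝ ∞ (coordField v₀.proj X) (extChartAt (𝓡 n).tangent v₀ u).1 := by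
  refine (contDiffOn_coordField v₀.proj hX).contDiffAt ((isOpen_extChartAt_target _).mem_nhds ?_)
  rw [extChartAt_tangent_apply hu]
  exact (extChartAt (𝓡 n) v₀.proj).map_source (mem_extChartAt_tangent_source.1 hu)

/-- A vector field preserving the Dazord form is divergence free for the density `det g` in every
induced chart. -/
theorem densityDiv_liftCoord (hF : IsFinsler F)
    (hX : ContMDiff (𝓡 n) (𝓡 n).tangent ∞ (fun p ↦ (⟨p, X p⟩ : TangentBundle (𝓡 n) M)))
    (hvol : PreservesVolume F X) (hu : u ∈ (extChartAt (𝓡 n).tangent v₀).source)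
    (hu0 : u ∈ deleted n M) :
    densityDiv (fun w ↦ (gram (energyCoord F v₀) w).det) (liftCoord (coordField v₀.proj X))
      (extChartAt (𝓡 n).tangent v₀ u) = 0 := by
  set z := extChartAt (𝓡 n).tangent v₀ u with hz
  set δ : Phase n → ℝ := fun w ↦ (gram (energyCoord F v₀) w).det with hδ
  set ξ := liftCoord (coordField v₀.proj X) with hξ
  obtain ⟨b, hb⟩ := exists_basis_wedgePow_stdForm_ne_zero n
  set T := wedgePow (stdForm n) n with hT
  set c : ℝ := (-1 : ℝ) ^ (n * (n - 1) / 2) / (n.factorial : ℝ) with hc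
  have hc0 : c ≠ 0 := div_ne_zero (pow_ne_zero _ (by norm_num))
    (Nat.cast_ne_zero.2 n.factorial_ne_zero)
  -- Test fields constant in the chart: their brackets with `X^c` reduce to minus the Jacobian of
  -- the lift applied to `b i`, and the sum over `i` becomes its trace.
  set η : Fin (2 * n) → (w : TangentBundle (𝓡 n) M) → TangentSpace (𝓡 n).tangent w :=
    fun i ↦ chartField (𝓡 n).tangent v₀ fun _ ↦ b i with hη
  have hηc : ∀ i, ∀ w ∈ (extChartAt (𝓡 n).tangent v₀).source,
      chartDeriv (𝓡 n).tangent v₀ w (η i w) = b i := fun i w hw ↦ chartDeriv_chartField hw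
  have hvol' := hvol u hu0 η fun i ↦ contMDiffAt_chartField hu contDiffAt_const
  have hδd : DifferentiableAt ℝ δ z :=
    (contDiffAt_det_gram (contDiffAt_energyCoord hF hu hu0)).differentiableAt (by simp)
  have hξd : DifferentiableAt ℝ ξ z :=
    (contDiffAt_liftCoord (contDiffAt_coordField hX hu)).differentiableAt (by simp)
  have hX' : ∀ᶠ w in 𝓝 u, chartDeriv (𝓡 n).tangent v₀ w (completeLift X w) =
      ξ (extChartAt (𝓡 n).tangent v₀ w) :=
    ((isOpen_extChartAt_source (I := (𝓡 n).tangent) v₀).eventually_mem hu).mono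
      fun w hw ↦ chartDeriv_completeLift hX hw
  have h1 := dirDeriv_eq_of_chart (f := fun y ↦ dazord F y fun i ↦ η i y)
    (f' := fun w ↦ c * (δ w * T b)) hu (by
      filter_upwards [eventually_mem_source_deleted hu hu0] with w hw
      refine (dazord_apply hF hw.1 hw.2 _).trans ?_
      simp only [hηc _ w hw.1]
      rfl) ((hδd.mul_const _).const_mul _) (completeLift X u)
  rw [hX'.self_of_nhds, ((hδd.hasFDerivAt.mul_const (T b)).const_mul c).fderiv] at h1
  have hbr : ∀ i, chartDeriv (𝓡 n).tangent v₀ u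
      (mlieBracket (𝓡 n).tangent (completeLift X) (η i) u) = -fderiv ℝ ξ z (b i) := fun i ↦ by
    have h := chartDeriv_mlieBracket (η' := fun _ ↦ b i) hu hX'
      (((isOpen_extChartAt_source (I := (𝓡 n).tangent) v₀).eventually_mem hu).mono
        fun w hw ↦ hηc i w hw) hξd (differentiableAt_const _)
    rw [h, lieBracket]
    simp [hz]
  have h2 : ∀ i, dazord F u (Function.update (fun j ↦ η j u) i
      (mlieBracket (𝓡 n).tangent (completeLift X) (η i) u)) =
      -(c * (δ z * T (Function.update b i (fderiv ℝ ξ z (b i))))) := fun i ↦ by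
    rw [dazord_apply hF hu hu0]
    have h3 : (fun j ↦ chartDeriv (𝓡 n).tangent v₀ u (Function.update (fun j ↦ η j u) i
        (mlieBracket (𝓡 n).tangent (completeLift X) (η i) u) j)) =
        Function.update b i ((-1 : ℝ) • fderiv ℝ ξ z (b i)) := by
      funext j
      rcases eq_or_ne j i with rfl | hj
      · rw [Function.update_self, Function.update_self, hbr, neg_one_smul]
      · rw [Function.update_of_ne hj, Function.update_of_ne hj, hηc _ u hu]
    rw [h3, AlternatingMap.map_update_smul]
    simp only [neg_one_smul, mul_neg]
    rfl
  rw [lieDerivForm, h1, Finset.sum_congr rfl fun i _ ↦ h2 i, Finset.sum_neg_distrib,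
    ← Finset.mul_sum, ← Finset.mul_sum] at hvol'
  have h4 := sum_update_eq_trace_mul T b (fderiv ℝ ξ z).toLinearMap
  have h5 : ∑ i, T (Function.update b i (fderiv ℝ ξ z (b i))) = traceL _ (fderiv ℝ ξ z) * T b := h4
  rw [h5] at hvol'
  refine (mul_eq_zero.1 (?_ : (c * T b) * densityDiv δ ξ z = 0)).resolve_left
    (mul_ne_zero hc0 hb)
  change c * (T b * fderiv ℝ δ z (ξ z)) - _ = 0 at hvol'
  rw [densityDiv]
  linear_combination hvol'

/-- The canonical spray in an induced chart. -/
theorem chartDeriv_canonicalSpray (hF : IsFinsler F)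
    (hu : u ∈ (extChartAt (𝓡 n).tangent v₀).source) (hu0 : u ∈ deleted n M) :
    chartDeriv (𝓡 n).tangent v₀ u (canonicalSpray F u) =
      sprayCoord (energyCoord F v₀) (extChartAt (𝓡 n).tangent v₀ u) := by
  set z := extChartAt (𝓡 n).tangent v₀ u with hz
  have hε := contDiffAt_energyCoord hF hu hu0
  have hε2 : ContDiffAt ℝ 2 (energyCoord F v₀) z := hε.of_le ENat.LEInfty.out
  have hdet := det_gram_energyCoord_ne_zero hF hu hu0
  have hdE : ∀ t, dirDeriv (𝓡 n).tangent (energy F) u t =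
      fderiv ℝ (energyCoord F v₀) z (chartDeriv (𝓡 n).tangent v₀ u t) :=
    dirDeriv_eq_of_chart hu (eventuallyEq_comp_extChartAt hu) (hε.differentiableAt (by simp))
  -- Existence gives the `epsilon` in `canonicalSpray` its defining property; nondegeneracy then
  -- identifies the chosen vector with the coordinate solution.
  have hP : ∃ s : TangentSpace (𝓡 n).tangent u, ∀ t : TangentSpace (𝓡 n).tangent u,
      fundForm F u ![s, t] = -dirDeriv (𝓡 n).tangent (energy F) u t := by
    obtain ⟨s, hs⟩ := chartDeriv_surjective hu (sprayCoord (energyCoord F v₀) z)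
    refine ⟨s, fun t ↦ ?_⟩
    rw [fundForm_apply hF hu hu0, hdE]
    refine Eq.trans ?_ (DFunLike.congr_fun (dForm_sprayCoord hε2 hdet) _)
    rw [← hs]
    rfl
  have hS := Classical.epsilon_spec hP
  have hSdef : canonicalSpray F u = Classical.epsilon fun s ↦
      ∀ t : TangentSpace (𝓡 n).tangent u,
        fundForm F u ![s, t] = -dirDeriv (𝓡 n).tangent (energy F) u t := if_neg hu0
  rw [← hSdef] at hS
  refine sub_eq_zero.1 (dForm_nondegenerate hε2 hdet fun b ↦ ?_)
  obtain ⟨t, rfl⟩ := chartDeriv_surjective hu b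
  have h1 := hS t
  rw [fundForm_apply hF hu hu0, hdE] at h1
  have h2 := DFunLike.congr_fun (dForm_sprayCoord hε2 hdet) (chartDeriv (𝓡 n).tangent v₀ u t)
  rw [map_sub, sub_apply, sub_eq_zero]
  exact h1.trans h2.symm

theorem vlift_injective : Function.Injective (vlift u) := by
  intro a b h
  have h1 := congrArg (chartDeriv (𝓡 n).tangent u u) h
  rw [chartDeriv_vlift (mem_extChartAt_source u), chartDeriv_vlift (mem_extChartAt_source u)] at h1
  exact chartDeriv_injective (mem_extChartAt_source u.proj) (congrArg Prod.snd h1)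

/-- The Lie derivative of a section that is constant in a chart. -/
theorem chartDeriv_lieDerivSection
    (hX : ContMDiff (𝓡 n) (𝓡 n).tangent ∞ (fun p ↦ (⟨p, X p⟩ : TangentBundle (𝓡 n) M)))
    (hu : u ∈ (extChartAt (𝓡 n).tangent v₀).source) (a : EuclideanSpace ℝ (Fin n)) :
    chartDeriv (𝓡 n) v₀.proj u.proj
      (lieDerivSection X (fun w ↦ chartField (𝓡 n) v₀.proj (fun _ ↦ a) w.proj) u) =
      -fderiv ℝ (coordField v₀.proj X) (extChartAt (𝓡 n).tangent v₀ u).1 a := by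
  have hp := mem_extChartAt_tangent_source.1 hu
  have hXs := contDiffAt_coordField hX hu
  set z := extChartAt (𝓡 n).tangent v₀ u with hz
  obtain ⟨s, hs⟩ := chartDeriv_surjective hp (-fderiv ℝ (coordField v₀.proj X) z.1 a)
  have hev := (isOpen_extChartAt_source (I := (𝓡 n).tangent) v₀).eventually_mem hu
  have h1 := chartDeriv_mlieBracket (ξ := completeLift X)
    (η := fun w : TangentBundle (𝓡 n) M ↦
      vlift w (chartField (𝓡 n) v₀.proj (fun _ ↦ a) w.proj))
    (ξ' := liftCoord (coordField v₀.proj X)) (η' := fun _ ↦ (0, a)) hu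
    (hev.mono fun w hw ↦ chartDeriv_completeLift hX hw)
    (hev.mono fun w hw ↦ by
      rw [chartDeriv_vlift hw, chartDeriv_chartField (mem_extChartAt_tangent_source.1 hw)])
    ((contDiffAt_liftCoord hXs).differentiableAt (by simp)) (differentiableAt_const _)
  -- The bracket is exhibited as a vertical lift, so that `Function.invFun` returns a true preimage.
  have h2 : mlieBracket (𝓡 n).tangent (completeLift X) (fun w : TangentBundle (𝓡 n) M ↦
      vlift w (chartField (𝓡 n) v₀.proj (fun _ ↦ a) w.proj)) u = vlift u s := by
    refine chartDeriv_injective hu ?_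
    rw [h1, chartDeriv_vlift hu, hs, lieBracket, fderiv_liftCoord hXs]
    simp
  rw [lieDerivSection, h2, Function.leftInverse_invFun vlift_injective, hs]

/-- Testing conformality on sections that are constant in a chart gives the matrix equation of
`conformalFactor_eq_zero` at each nonzero vector. -/
theorem isIsometric_of_isConformal (hn : n ≠ 0) (hF : IsFinsler F)
    (hX : ContMDiff (𝓡 n) (𝓡 n).tangent ∞ (fun p ↦ (⟨p, X p⟩ : TangentBundle (𝓡 n) M)))
    (hvol : PreservesVolume F X) (h : IsConformal F X) : IsIsometric F X := by
  obtain ⟨φ, -, -, hφ⟩ := h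
  suffices hφ0 : ∀ v ∈ deleted n M, φ v = 0 by
    intro v hv Y Z hY hZ
    rw [hφ v hv Y Z hY hZ, hφ0 v hv]
  intro v hv
  have hs := mem_extChartAt_source (I := (𝓡 n).tangent) v
  have hp := mem_extChartAt_source (I := 𝓡 n) v.proj
  have hε := contDiffAt_energyCoord hF hs hv
  refine conformalFactor_eq_zero hn hε (det_gram_energyCoord_ne_zero hF hs hv)
    (contDiffAt_coordField hX hs) (densityDiv_liftCoord hF hX hvol hs hv) fun a b ↦ ?_
  have hsm : ∀ a : EuclideanSpace ℝ (Fin n), ContMDiffAt (𝓡 n).tangent (𝓡 n).tangent ∞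
      (fun w : TangentBundle (𝓡 n) M ↦
        (⟨w.proj, chartField (𝓡 n) v.proj (fun _ ↦ a) w.proj⟩ : TangentBundle (𝓡 n) M)) v :=
    fun a ↦ (contMDiffAt_chartField hp contDiffAt_const).comp v
      (contMDiff_proj (n := ∞) (TangentSpace (𝓡 n)) v)
  have h := hφ v hv _ _ (hsm a) (hsm b)
  have hD2 := (hε.fderiv_right (m := ∞) (by simp)).fderiv_right (m := ∞) (by simp)
  rw [lieDerivMetric, dirDeriv_eq_of_chart (f' := fun w ↦
    fderiv ℝ (fderiv ℝ (energyCoord F v)) w (0, a) (0, b)) hs (by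
      filter_upwards [eventually_mem_source_deleted hs hv] with w hw
      rw [metric_eq hF hw.1 hw.2, chartDeriv_chartField (mem_extChartAt_tangent_source.1 hw.1),
        chartDeriv_chartField (mem_extChartAt_tangent_source.1 hw.1)]
      rfl)
    (((hD2.clm_apply contDiffAt_const).clm_apply contDiffAt_const).differentiableAt (by simp)),
    chartDeriv_completeLift hX hs, metric_eq hF hs hv, metric_eq hF hs hv, metric_eq hF hs hv,
    chartDeriv_lieDerivSection hX hs, chartDeriv_lieDerivSection hX hs,
    chartDeriv_chartField hp, chartDeriv_chartField hp] at h
  have hneg : ∀ x : EuclideanSpace ℝ (Fin n), ((0, -x) : Phase n) = -(0, x) := fun x ↦ by simp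
  rw [hneg, hneg, map_neg, map_neg, neg_apply, sub_neg_eq_add, sub_neg_eq_add] at h
  exact h

end FinslerFields

/-! ### Homogeneity along rays and the projective case. -/

section Projective

variable {n : ℕ} {M : Type*} [TopologicalSpace M] [ChartedSpace (EuclideanSpace ℝ (Fin n)) M]
  [IsManifold (𝓡 n) ∞ M] {v₀ u : TangentBundle (𝓡 n) M} {F : TangentBundle (𝓡 n) M → ℝ}
  {X : (p : M) → TangentSpace (𝓡 n) p}

/-- The fibrewise dilation `(x, y) ↦ (x, t y)`. -/
noncomputable def dilation (n : ℕ) (t : ℝ) : Phase n →L[ℝ] Phase n :=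
  (ContinuousLinearMap.fst ℝ _ _).prod (t • ContinuousLinearMap.snd ℝ _ _)

theorem dilation_apply (t : ℝ) (z : Phase n) : dilation n t z = (z.1, t • z.2) := rfl

theorem extChartAt_tangent_smul (hu : u ∈ (extChartAt (𝓡 n).tangent v₀).source) (t : ℝ) :
    extChartAt (𝓡 n).tangent v₀ ⟨u.proj, t • u.snd⟩ =
      dilation n t (extChartAt (𝓡 n).tangent v₀ u) := by
  rw [extChartAt_tangent_mk (mem_extChartAt_tangent_source.1 hu), extChartAt_tangent_apply hu,
    map_smul]
  rfl

theorem energyCoord_dilation (hF : IsFinsler F) {t : ℝ} (ht : 0 < t) {z : Phase n}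
    (hz : z ∈ (extChartAt (𝓡 n).tangent v₀).target) :
    energyCoord F v₀ (dilation n t z) = t ^ 2 * energyCoord F v₀ z := by
  have hu := (extChartAt (𝓡 n).tangent v₀).map_target hz
  set u := (extChartAt (𝓡 n).tangent v₀).symm z with hu'
  have hzu : z = extChartAt (𝓡 n).tangent v₀ u :=
    ((extChartAt (𝓡 n).tangent v₀).right_inv hz).symm
  rw [hzu, ← extChartAt_tangent_smul hu, energyCoord_extChartAt hu,
    energyCoord_extChartAt (u := ⟨u.proj, t • u.snd⟩)
      (mem_extChartAt_tangent_source.2 (mem_extChartAt_tangent_source.1 hu)),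
    energy, energy, hF.homog _ _ _ ht]
  ring

/-- The energy scales by `t ^ 2` under a dilation, and each of the two vertical derivatives absorbs
one factor `t`. -/
theorem gram_energyCoord_dilation (hF : IsFinsler F)
    (hu : u ∈ (extChartAt (𝓡 n).tangent v₀).source) (hu0 : u ∈ deleted n M) {t : ℝ} (ht : 0 < t) :
    gram (energyCoord F v₀) (dilation n t (extChartAt (𝓡 n).tangent v₀ u)) =
      gram (energyCoord F v₀) (extChartAt (𝓡 n).tangent v₀ u) := by
  set z := extChartAt (𝓡 n).tangent v₀ u with hz
  have hε := contDiffAt_energyCoord hF hu hu0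
  have hεt : ContDiffAt ℝ 2 (energyCoord F v₀) (0 + dilation n t z) := by
    rw [zero_add, hz, ← extChartAt_tangent_smul hu]
    exact (contDiffAt_energyCoord (u := ⟨u.proj, t • u.snd⟩) hF
      (mem_extChartAt_tangent_source.2 (mem_extChartAt_tangent_source.1 hu))
      (smul_ne_zero ht.ne' hu0)).of_le ENat.LEInfty.out
  have h1 : (fun w ↦ energyCoord F v₀ (0 + dilation n t w)) =ᶠ[𝓝 z]
      fun w ↦ t ^ 2 • energyCoord F v₀ w := by
    filter_upwards [(isOpen_extChartAt_target (I := (𝓡 n).tangent) v₀).mem_nhds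
      ((extChartAt (𝓡 n).tangent v₀).map_source hu)] with w hw
    rw [zero_add, energyCoord_dilation hF ht hw, smul_eq_mul]
  have h2 : fderiv ℝ (fun w ↦ t ^ 2 • energyCoord F v₀ w) =
      fun w ↦ t ^ 2 • fderiv ℝ (energyCoord F v₀) w :=
    fderiv_const_smul_field (f := energyCoord F v₀) (t ^ 2)
  have h3 : fderiv ℝ (fun w ↦ t ^ 2 • fderiv ℝ (energyCoord F v₀) w) z =
      t ^ 2 • fderiv ℝ (fderiv ℝ (energyCoord F v₀)) z :=
    congrFun (fderiv_const_smul_field (f := fderiv ℝ (energyCoord F v₀)) (t ^ 2)) z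
  ext i j
  have h4 := fderiv_fderiv_comp_add (f := energyCoord F v₀) 0 (dilation n t) hεt
    (0, EuclideanSpace.basisFun (Fin n) ℝ i) (0, EuclideanSpace.basisFun (Fin n) ℝ j)
  rw [h1.fderiv.fderiv_eq, h2, h3, zero_add] at h4
  have h5 : ∀ x : EuclideanSpace ℝ (Fin n), dilation n t (0, x) = t • (0, x) := fun x ↦ by
    rw [dilation_apply]
    simp
  rw [h5, h5, map_smul, map_smul] at h4
  have h6 : t ^ 2 * gram (energyCoord F v₀) z i j =
      t * (t * gram (energyCoord F v₀) (dilation n t z) i j) := h4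
  have ht2 : t ^ 2 ≠ 0 := pow_ne_zero _ ht.ne'
  refine mul_left_cancel₀ ht2 ?_
  linear_combination -h6

theorem fderiv_det_gram_energyCoord_vert (hF : IsFinsler F)
    (hu : u ∈ (extChartAt (𝓡 n).tangent v₀).source) (hu0 : u ∈ deleted n M) :
    fderiv ℝ (fun w ↦ (gram (energyCoord F v₀) w).det) (extChartAt (𝓡 n).tangent v₀ u)
      (0, (extChartAt (𝓡 n).tangent v₀ u).2) = 0 := by
  set z := extChartAt (𝓡 n).tangent v₀ u with hz
  have hδ : DifferentiableAt ℝ (fun w ↦ (gram (energyCoord F v₀) w).det) (z.1, (1 : ℝ) • z.2) := by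
    rw [one_smul]
    exact (contDiffAt_det_gram (contDiffAt_energyCoord hF hu hu0)).differentiableAt (by simp)
  have hc : HasDerivAt (fun t : ℝ ↦ (z.1, t • z.2)) (0, (1 : ℝ) • z.2) 1 :=
    (hasDerivAt_const _ _).prodMk ((hasDerivAt_id 1).smul_const z.2)
  have h1 := hδ.hasFDerivAt.comp_hasDerivAt 1 hc
  have h2 : (fun w ↦ (gram (energyCoord F v₀) w).det) ∘ (fun t : ℝ ↦ (z.1, t • z.2)) =ᶠ[𝓝 1]
      fun _ ↦ (gram (energyCoord F v₀) z).det := by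
    filter_upwards [lt_mem_nhds one_pos] with t ht
    exact congrArg Matrix.det (gram_energyCoord_dilation hF hu hu0 ht)
  have h3 := h1.unique ((hasDerivAt_const (1 : ℝ) _).congr_of_eventuallyEq h2)
  rwa [one_smul] at h3

/-- The bracket `φ C` inherits zero divergence from `X^c` and the spray. As `det g` is constant
along rays and `C` has divergence `n`, this is an Euler equation for `φ`. -/
theorem fderiv_liouville_of_isProjective (hF : IsFinsler F)
    (hX : ContMDiff (𝓡 n) (𝓡 n).tangent ∞ (fun p ↦ (⟨p, X p⟩ : TangentBundle (𝓡 n) M)))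
    (hvol : PreservesVolume F X) {φ : TangentBundle (𝓡 n) M → ℝ}
    (hφs : ContMDiffOn (𝓡 n).tangent 𝓘(ℝ, ℝ) ∞ φ (deleted n M))
    (hφ : ∀ v, mlieBracket (𝓡 n).tangent (completeLift X) (canonicalSpray F) v =
      φ v • liouville v)
    (hu : u ∈ (extChartAt (𝓡 n).tangent v₀).source) (hu0 : u ∈ deleted n M) :
    fderiv ℝ (fun z ↦ φ ((extChartAt (𝓡 n).tangent v₀).symm z)) (extChartAt (𝓡 n).tangent v₀ u)
      (0, (extChartAt (𝓡 n).tangent v₀ u).2) = -n * φ u := by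
  set z := extChartAt (𝓡 n).tangent v₀ u with hz
  set ψ : Phase n → ℝ := fun z ↦ φ ((extChartAt (𝓡 n).tangent v₀).symm z) with hψ
  have hψu : ∀ w ∈ (extChartAt (𝓡 n).tangent v₀).source,
      ψ (extChartAt (𝓡 n).tangent v₀ w) = φ w := fun w hw ↦ by
    rw [hψ]
    exact congrArg φ ((extChartAt (𝓡 n).tangent v₀).left_inv hw)
  have hε := contDiffAt_energyCoord hF hu hu0
  have hdet := det_gram_energyCoord_ne_zero hF hu hu0
  have hev := eventually_mem_source_deleted hu hu0
  have hbr : lieBracket ℝ (liftCoord (coordField v₀.proj X)) (sprayCoord (energyCoord F v₀)) =ᶠ[𝓝 z]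
      fun w ↦ ψ w • liouvilleCoord n w := by
    refine eventually_extChartAt_of_eventually hu ?_
    filter_upwards [hev] with w hw
    have h := chartDeriv_mlieBracket (ξ := completeLift X) (η := canonicalSpray F) hw.1
      ((eventually_mem_source_deleted hw.1 hw.2).mono
        fun w hw ↦ chartDeriv_completeLift hX hw.1)
      ((eventually_mem_source_deleted hw.1 hw.2).mono
        fun w hw ↦ chartDeriv_canonicalSpray hF hw.1 hw.2)
      ((contDiffAt_liftCoord (contDiffAt_coordField hX hw.1)).differentiableAt (by simp))
      ((contDiffAt_sprayCoord (contDiffAt_energyCoord hF hw.1 hw.2)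
        (det_gram_energyCoord_ne_zero hF hw.1 hw.2)).differentiableAt (by simp))
    rw [hφ, map_smul, chartDeriv_liouville hw.1] at h
    rw [hψu w hw.1]
    exact h.symm
  have hdiv := densityDiv_lieBracket
    ((contDiffAt_det_gram hε).of_le ENat.LEInfty.out)
    ((contDiffAt_liftCoord (contDiffAt_coordField hX hu)).of_le ENat.LEInfty.out)
    ((contDiffAt_sprayCoord hε hdet).of_le ENat.LEInfty.out)
    (eventually_extChartAt_of_eventually hu
      (hev.mono fun w hw ↦ densityDiv_liftCoord hF hX hvol hw.1 hw.2))
    (eventually_extChartAt_of_eventually hu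
      (hev.mono fun w hw ↦ densityDiv_sprayCoord (contDiffAt_energyCoord hF hw.1 hw.2)
        (det_gram_energyCoord_ne_zero hF hw.1 hw.2)))
  rw [densityDiv, hbr.fderiv_eq, hbr.self_of_nhds] at hdiv
  rw [← hψu u hu]
  exact fderiv_liouville_of_densityDiv
    ((contDiffAt_comp_extChartAt_symm le_rfl hφs hu hu0).differentiableAt (by simp))
    (fderiv_det_gram_energyCoord_vert hF hu hu0) hdet hdiv

theorem isAffine_of_isProjective (hn : n ≠ 0) (hF : IsFinsler F)
    (hX : ContMDiff (𝓡 n) (𝓡 n).tangent ∞ (fun p ↦ (⟨p, X p⟩ : TangentBundle (𝓡 n) M)))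
    (hvol : PreservesVolume F X) (h : IsProjective F X) : IsAffine F X := by
  obtain ⟨φ, hφc, hφs, hφ⟩ := h
  intro v
  rw [hφ]
  rcases eq_or_ne v.snd 0 with hv | hv
  · rw [liouville, hv, map_zero, smul_zero]
  have hs := mem_extChartAt_source (I := (𝓡 n).tangent) v
  set z := extChartAt (𝓡 n).tangent v v with hz
  set ψ : Phase n → ℝ := fun z ↦ φ ((extChartAt (𝓡 n).tangent v).symm z) with hψ
  have hst : ∀ t : ℝ, (⟨v.proj, t • v.snd⟩ : TangentBundle (𝓡 n) M) ∈
      (extChartAt (𝓡 n).tangent v).source := fun t ↦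
    mem_extChartAt_tangent_source.2 (mem_extChartAt_tangent_source.1 hs)
  -- The ray includes `t = 0`, where it meets the zero section; continuity of `φ` there excludes a
  -- nonzero solution of degree `-n`.
  have hcont : Continuous fun t : ℝ ↦ φ ⟨v.proj, t • v.snd⟩ :=
    hφc.comp ((contMDiff_fiber_inclusion v.proj).continuous.comp
      (continuous_id.smul (continuous_const (y := (v.snd : EuclideanSpace ℝ (Fin n))))))
  have hψt : ∀ t : ℝ, φ ⟨v.proj, t • v.snd⟩ = ψ (z.1, t • z.2) := fun t ↦ by
    refine (congrArg φ ((extChartAt (𝓡 n).tangent v).left_inv (hst t))).symm.trans ?_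
    rw [extChartAt_tangent_smul hs]
    rfl
  have h0 := eq_zero_of_homogeneous_neg (f := fun t : ℝ ↦ φ ⟨v.proj, t • v.snd⟩)
    (f' := fun t ↦ fderiv ℝ ψ (z.1, t • z.2) (0, z.2)) hn hcont.continuousAt
    (fun t ht ↦ ?_) fun t ht ↦ ?_
  · rw [show φ v = 0 by simpa using h0, zero_smul]
  · have hd := (contDiffAt_comp_extChartAt_symm le_rfl hφs (hst t)
      (smul_ne_zero ht.ne' hv)).differentiableAt (by simp)
    rw [extChartAt_tangent_smul hs] at hd
    have hc : HasDerivAt (fun t : ℝ ↦ (z.1, t • z.2)) (0, (1 : ℝ) • z.2) t :=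
      (hasDerivAt_const _ _).prodMk ((hasDerivAt_id t).smul_const z.2)
    rw [one_smul] at hc
    simp only [hψt]
    exact HasFDerivAt.comp_hasDerivAt (l := ψ) t hd.hasFDerivAt hc
  · have h1 := fderiv_liouville_of_isProjective hF hX hvol hφs hφ (hst t)
      (smul_ne_zero ht.ne' hv)
    rw [extChartAt_tangent_smul hs] at h1
    refine Eq.trans ?_ h1
    rw [← smul_eq_mul, ← map_smul]
    simp [dilation_apply, hz, hψ]

end Projective

end Finsler

theorem mainTheorem3 {n : ℕ} (hn : 2 ≤ n) {M : Type*} [TopologicalSpace M]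
    [ChartedSpace (EuclideanSpace ℝ (Fin n)) M] [IsManifold (𝓡 n) ∞ M]
    [T2Space M] [SecondCountableTopology M] [ConnectedSpace M]
    (F : TangentBundle (𝓡 n) M → ℝ) (hF : Finsler.IsFinsler F)
    (X : (p : M) → TangentSpace (𝓡 n) p)
    (hX : ContMDiff (𝓡 n) (𝓡 n).tangent ∞ (fun p ↦ (⟨p, X p⟩ : TangentBundle (𝓡 n) M)))
    (hvol : Finsler.PreservesVolume F X) :
    (Finsler.IsProjective F X → Finsler.IsAffine F X) ∧
      (Finsler.IsConformal F X → Finsler.IsIsometric F X) :=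
  ⟨Finsler.isAffine_of_isProjective (by omega) hF hX hvol,
    Finsler.isIsometric_of_isConformal (by omega) hF hX hvol⟩
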